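/- **Setting.** Let $\mathcal H$ be a complex Hilbert space and $h$ a self-adjoint operator on $\mathcal H$ with compact resolvent, bounded below. Let $\{\psi_j\}_{j\in\mathcal J}$ be an orthonormal basis of $\mathcal H$ with $h\psi_j=e_j\psi_j$. Let $\mathcal H_N=\mathcal H^{\otimes N}$, $H_N=\sum_{j=1}^N h_j$ (with $h_j$ acting as $h$ on the $j$th factor), and for $\alpha\in\mathcal J^N$ let $\Psi_\alpha=\psi_{\alpha_1}\otimes\cdots\otimes\psi_{\alpha_N}$. Let $P_E$ be the orthogonal projection onto the eigenspace of $H_N$ with eigenvalue $E$, and let $\mathcal A_N$ be the algebra of bounded operators $\sum_E f(E)P_E$ with $f$ bounded (strongly convergent sums). A *collision specification* $(\mathcal C,U,\nu)$ consists of a compact metric space $\mathcal C$, a (strongly) continuous one-to-one map $U$ from $\mathcal C$ to the unitary group of $\mathcal H_2$, and a Borel probability measure $\nu$ on $\mathcal C$ charging every non-empty open set, such that (i) each $U(\sigma)$ commutes with $H_2$; (ii) $U(\sigma_0)=1$ for some $\sigma_0$; (iii) $\{U(\sigma)^*\}=\{U(\sigma)\}$ and the map $\sigma\mapsto\sigma'$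 with $U(\sigma)^*=U(\sigma')$ is measurable and preserves $\nu$; (iv) the same holds with $VU(\sigma)V^*$ in place of $U(\sigma)^*$, where $V(\phi\otimes\psi)=\psi\otimes\phi$. It is *ergodic* if the commutant $\{U(\sigma):\sigma\in\mathcal C\}'$ in the bounded operators on $\mathcal H_2$ equals $\mathcal A_2$. Let $N\ge 2$. For $i<j$ let $U_{i,j}(\sigma)$ be $U(\sigma)$ acting on the factors $i,j$ of $\mathcal H_N$, and for bounded $A$ on $\mathcal H_N$ put $$\mathcal L_N A=N\Bigl(\tbinom N2^{-1}\sum_{i<j}\int_{\mathcal C}U_{i,j}(\sigma)\,A\,U_{i,j}(\sigma)^*\,d\nu(\sigma)-A\Bigr),$$ the integral being taken in the strong operator topology. Let $\mathcal C_N=\{U_{i,j}(\sigma): i<j,\ \sigma\in\mathcal C\}'$. A non-zero orthogonal projection $P\in\mathcal C_N$ is *minimal* if every non-zero orthogonal projection $Q\in\mathcal C_N$ with $Q\le P$ equals $P$. Indices $\alpha,\alpha'\in\mathcal J^N$ are *adjacent* if for some $i<j$ one has $e_{\alpha_i}+e_{\alpha_j}=e_{\alpha'_i}+e_{\alpha'_j}$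 and $\alpha_k=\alpha'_k$ for all $k\ne i,j$; they are *equivalent*, $\alpha\sim\alpha'$, if they are joined by a finite sequence of successively adjacent indices. A density matrix is a positive trace class operator of trace $1$. **Theorem.** Let $(\mathcal C,U,\nu)$ be an ergodic collision specification and $N\ge2$. Then: 1. Every equivalence class of $\sim$ in $\mathcal J^N$ is finite, and the minimal projections of $\mathcal C_N$ are exactly the operators $P=\sum_{\alpha\sim\alpha_0}|\Psi_\alpha\rangle\langle\Psi_\alpha|$ with $\alpha_0\in\mathcal J^N$. In particular each minimal projection $P$ has finite rank, and $P/\operatorname{Tr}P$ is a density matrix. 2. A density matrix $\varrho$ on $\mathcal H_N$ satisfies $\mathcal L_N\varrho=0$ if and only if it is a (finite or countably infinite) convex combination of normalized minimal projections of $\mathcal C_N$, i.e. $\varrho=\sum_P w_P\,P/\operatorname{Tr}P$, the sum being over the minimal projections $P$ of $\mathcal C_N$, with $w_P\ge0$ and $\sum_P w_P=1$. (The series converges in operator norm, equivalently in trace norm.) -/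

import Mathlib

open scoped InnerProductSpace

noncomputable section

namespace QKac

open MeasureTheory Filter Topology

/-! ### Square-summable families and amplification of operators -/

/-- `ℓ²(X)` with complex coefficients. -/
abbrev L2 (X : Type*) : Type _ := lp (fun _ : X => ℂ) 2

section Amplification

variable {X Y Z : Type*}

theorem memL2_iff {f : Z → ℂ} : Memℓp f 2 ↔ Summable fun z => ‖f z‖ ^ 2 := by
  rw [memℓp_gen_iff (by norm_num)]
  simp

theorem L2.summable_sq (f : L2 Z) : Summable fun z => ‖f z‖ ^ 2 := memL2_iff.1 (lp.memℓp f)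

theorem L2.norm_sq (f : L2 Z) : ‖f‖ ^ 2 = ∑' z, ‖f z‖ ^ 2 := by
  have h := lp.norm_rpow_eq_tsum (p := 2) (by norm_num) f
  simpa using h

/-- For an identification `E : X × Y ≃ Z`, the slice `y ↦ f (E (x, y))` of `f ∈ ℓ²(Z)`. -/
def slice (E : X × Y ≃ Z) (f : L2 Z) (x : X) : L2 Y :=
  ⟨fun y => f (E (x, y)), memL2_iff.2
    ((L2.summable_sq f).comp_injective (i := fun y => E (x, y)) fun _ _ h => by
      simpa using h)⟩

@[simp] theorem slice_apply (E : X × Y ≃ Z) (f : L2 Z) (x : X) (y : Y) :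
    slice E f x y = f (E (x, y)) := rfl

theorem slice_add (E : X × Y ≃ Z) (f g : L2 Z) (x : X) :
    slice E (f + g) x = slice E f x + slice E g x := by ext y; simp

theorem slice_smul (E : X × Y ≃ Z) (c : ℂ) (f : L2 Z) (x : X) :
    slice E (c • f) x = c • slice E f x := by ext y; simp

theorem summable_slice (E : X × Y ≃ Z) (f : L2 Z) : Summable fun x => ‖slice E f x‖ ^ 2 := by
  have h := (E.summable_iff (f := fun z => ‖f z‖ ^ 2)).2 (L2.summable_sq f)
  have h2 := ((summable_prod_of_nonneg (fun x => sq_nonneg ‖f (E x)‖)).1 h).2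
  simpa [L2.norm_sq] using h2

theorem norm_sq_eq_tsum_slice (E : X × Y ≃ Z) (f : L2 Z) :
    ‖f‖ ^ 2 = ∑' x, ‖slice E f x‖ ^ 2 := by
  have h := (E.summable_iff (f := fun z => ‖f z‖ ^ 2)).2 (L2.summable_sq f)
  have h2 := h.tsum_prod
  rw [L2.norm_sq, ← E.tsum_eq]
  refine h2.trans (tsum_congr fun x => ?_)
  rw [L2.norm_sq]
  rfl

theorem amp_mem (E : X × Y ≃ Z) (A : L2 Y →L[ℂ] L2 Y) (f : L2 Z) :
    Memℓp (fun z => A (slice E f (E.symm z).1) (E.symm z).2) 2 := by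
  rw [memL2_iff, ← E.summable_iff]
  refine (summable_prod_of_nonneg (fun x => sq_nonneg
    ‖A (slice E f (E.symm (E x)).1) (E.symm (E x)).2‖)).2 ⟨fun x => ?_, ?_⟩
  · refine (L2.summable_sq (A (slice E f x))).congr fun y => ?_
    rw [E.symm_apply_apply]
  · have : ∀ x, ∑' y, ((fun z => ‖A (slice E f (E.symm z).1) (E.symm z).2‖ ^ 2) ∘ E) (x, y)
        = ‖A (slice E f x)‖ ^ 2 := fun x => by
      rw [L2.norm_sq]
      refine tsum_congr fun y => ?_
      simp only [Function.comp_apply, E.symm_apply_apply]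
    refine Summable.congr ?_ fun x => (this x).symm
    refine Summable.of_nonneg_of_le (fun _ => by positivity) (fun x => ?_)
      ((summable_slice E f).mul_left (‖A‖ ^ 2))
    rw [← mul_pow]
    gcongr
    exact A.le_opNorm _

/-- The operator on `ℓ²(Z) ≅ ℓ²(X) ⊗ ℓ²(Y)` acting as `1 ⊗ A`: apply `A` to every slice. -/
def ampFun (E : X × Y ≃ Z) (A : L2 Y →L[ℂ] L2 Y) (f : L2 Z) : L2 Z :=
  ⟨fun z => A (slice E f (E.symm z).1) (E.symm z).2, amp_mem E A f⟩

theorem slice_ampFun (E : X × Y ≃ Z) (A : L2 Y →L[ℂ] L2 Y) (f : L2 Z) (x : X) :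
    slice E (ampFun E A f) x = A (slice E f x) := by
  ext y; simp [ampFun]

theorem norm_ampFun_le (E : X × Y ≃ Z) (A : L2 Y →L[ℂ] L2 Y) (f : L2 Z) :
    ‖ampFun E A f‖ ≤ ‖A‖ * ‖f‖ := by
  refine le_of_sq_le_sq ?_ (by positivity)
  rw [mul_pow, norm_sq_eq_tsum_slice E, norm_sq_eq_tsum_slice E f, ← tsum_mul_left]
  have hs := summable_slice E (ampFun E A f)
  simp_rw [slice_ampFun] at hs ⊢
  refine hs.tsum_le_tsum (fun x => ?_) ((summable_slice E f).mul_left _)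
  rw [← mul_pow]
  gcongr
  exact A.le_opNorm _

/-- The amplification `1 ⊗ A` of a bounded operator `A` on `ℓ²(Y)` to `ℓ²(Z) ≅ ℓ²(X) ⊗ ℓ²(Y)`. -/
def amp (E : X × Y ≃ Z) (A : L2 Y →L[ℂ] L2 Y) : L2 Z →L[ℂ] L2 Z :=
  LinearMap.mkContinuous
    { toFun := ampFun E A
      map_add' := fun f g => by
        ext z
        change A (slice E (f + g) _) _ = A (slice E f _) _ + A (slice E g _) _
        simp [slice_add]
      map_smul' := fun c f => by ext z; simp [ampFun, slice_smul] }
    ‖A‖ (norm_ampFun_le E A)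

theorem amp_apply (E : X × Y ≃ Z) (A : L2 Y →L[ℂ] L2 Y) (f : L2 Z) (z : Z) :
    amp E A f z = A (slice E f (E.symm z).1) (E.symm z).2 := rfl

theorem slice_amp (E : X × Y ≃ Z) (A : L2 Y →L[ℂ] L2 Y) (f : L2 Z) (x : X) :
    slice E (amp E A f) x = A (slice E f x) := slice_ampFun E A f x

theorem slice_ext (E : X × Y ≃ Z) {f g : L2 Z} (h : ∀ x, slice E f x = slice E g x) : f = g := by
  ext z
  have := congrArg (fun k : L2 Y => k (E.symm z).2) (h (E.symm z).1)
  simpa using this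

theorem amp_one (E : X × Y ≃ Z) : amp E 1 = 1 := by
  ext1 f
  exact slice_ext E fun x => by simp [slice_amp]

theorem amp_mul (E : X × Y ≃ Z) (A B : L2 Y →L[ℂ] L2 Y) :
    amp E (A * B) = amp E A * amp E B := by
  ext1 f
  exact slice_ext E fun x => by simp [slice_amp]

theorem inner_eq_tsum_slice (E : X × Y ≃ Z) (f g : L2 Z) :
    ⟪f, g⟫_ℂ = ∑' x, ⟪slice E f x, slice E g x⟫_ℂ := by
  have h := (E.summable_iff (f := fun z => ⟪f z, g z⟫_ℂ)).2 (lp.summable_inner f g)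
  have h2 := h.tsum_prod
  rw [lp.inner_eq_tsum, ← E.tsum_eq]
  exact h2

theorem amp_star (E : X × Y ≃ Z) (A : L2 Y →L[ℂ] L2 Y) : amp E (star A) = star (amp E A) := by
  rw [ContinuousLinearMap.star_eq_adjoint, ContinuousLinearMap.star_eq_adjoint,
    ContinuousLinearMap.eq_adjoint_iff]
  intro f g
  rw [inner_eq_tsum_slice E, inner_eq_tsum_slice E]
  simp_rw [slice_amp, ContinuousLinearMap.adjoint_inner_left]

theorem amp_mem_unitary (E : X × Y ≃ Z) {A : L2 Y →L[ℂ] L2 Y} (hA : A ∈ unitary (L2 Y →L[ℂ] L2 Y)) :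
    amp E A ∈ unitary (L2 Z →L[ℂ] L2 Z) := by
  rw [Unitary.mem_iff] at hA ⊢
  rw [← amp_star, ← amp_mul, ← amp_mul, hA.1, hA.2, amp_one]
  exact ⟨rfl, rfl⟩

theorem norm_apply_le_of_mem_unitary {K : Type*} [NormedAddCommGroup K] [InnerProductSpace ℂ K]
    [CompleteSpace K] {W : K →L[ℂ] K} (hW : W ∈ unitary (K →L[ℂ] K)) (v : K) : ‖W v‖ ≤ ‖v‖ :=
  (ContinuousLinearMap.norm_map_of_mem_unitary hW v).le

theorem continuous_amp {C : Type*} [TopologicalSpace C] (E : X × Y ≃ Z)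
    {U : C → L2 Y →L[ℂ] L2 Y} (hU : ∀ σ, U σ ∈ unitary (L2 Y →L[ℂ] L2 Y))
    (hc : ∀ v, Continuous fun σ => U σ v) (f : L2 Z) : Continuous fun σ => amp E (U σ) f := by
  rw [continuous_iff_continuousAt]
  intro σ₀
  rw [ContinuousAt, tendsto_iff_norm_sub_tendsto_zero]
  have key : Tendsto (fun σ => ‖amp E (U σ) f - amp E (U σ₀) f‖ ^ 2) (𝓝 σ₀) (𝓝 0) := by
    have h1 : ∀ σ, ‖amp E (U σ) f - amp E (U σ₀) f‖ ^ 2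
        = ∑' x, ‖U σ (slice E f x) - U σ₀ (slice E f x)‖ ^ 2 := fun σ => by
      rw [norm_sq_eq_tsum_slice E]
      refine tsum_congr fun x => ?_
      have : slice E (amp E (U σ) f - amp E (U σ₀) f) x
          = slice E (amp E (U σ) f) x - slice E (amp E (U σ₀) f) x := by ext y; simp
      rw [this, slice_amp, slice_amp]
    simp_rw [h1]
    have h0 : (0 : ℝ) = ∑' _ : X, (0 : ℝ) := by simp
    rw [h0]
    refine tendsto_tsum_of_dominated_convergence (bound := fun x => (2 * ‖slice E f x‖) ^ 2) ?_ ?_ ?_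
    · simp_rw [mul_pow]
      exact (summable_slice E f).mul_left _
    · intro x
      have := ((hc (slice E f x)).tendsto σ₀)
      rw [tendsto_iff_norm_sub_tendsto_zero] at this
      simpa using this.pow 2
    · refine Eventually.of_forall fun σ x => ?_
      rw [Real.norm_of_nonneg (by positivity)]
      gcongr
      calc _ ≤ ‖U σ (slice E f x)‖ + ‖U σ₀ (slice E f x)‖ := norm_sub_le _ _
        _ ≤ ‖slice E f x‖ + ‖slice E f x‖ := by
          gcongr <;> exact norm_apply_le_of_mem_unitary (hU _) _
        _ = _ := by ring
  have := key.sqrt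
  simpa using this

theorem continuous_star_apply {C K : Type*} [TopologicalSpace C] [NormedAddCommGroup K]
    [InnerProductSpace ℂ K] [CompleteSpace K] {W : C → K →L[ℂ] K}
    (hW : ∀ σ, W σ ∈ unitary (K →L[ℂ] K)) (hc : ∀ v, Continuous fun σ => W σ v) (v : K) :
    Continuous fun σ => (star (W σ)) v := by
  rw [continuous_iff_continuousAt]
  intro σ₀
  rw [ContinuousAt, tendsto_iff_norm_sub_tendsto_zero]
  set w := star (W σ₀) v with hw
  have hv : W σ₀ w = v := by
    have := congrArg (fun T : K →L[ℂ] K => T v) (Unitary.mem_iff.1 (hW σ₀)).2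
    simpa using this
  have h0 : Tendsto (fun σ => ‖W σ w - v‖) (𝓝 σ₀) (𝓝 0) := by
    have := (hc w).tendsto σ₀
    rw [hv] at this
    exact tendsto_iff_norm_sub_tendsto_zero.1 this
  refine squeeze_zero (fun _ => norm_nonneg _) (fun σ => ?_) h0
  have h1 : star (W σ) v - w = star (W σ) (v - W σ w) := by
    have := congrArg (fun T : K →L[ℂ] K => T w) (Unitary.mem_iff.1 (hW σ)).1
    simp only [mul_apply_eq_comp, one_apply_eq_self] at this
    rw [map_sub, this]
  rw [h1, norm_sub_rev (W σ w)]
  exact norm_apply_le_of_mem_unitary (Unitary.star_mem (hW σ)) _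

theorem continuous_conj_apply {C K : Type*} [TopologicalSpace C] [NormedAddCommGroup K]
    [InnerProductSpace ℂ K] [CompleteSpace K] {W : C → K →L[ℂ] K}
    (hW : ∀ σ, W σ ∈ unitary (K →L[ℂ] K)) (hc : ∀ v, Continuous fun σ => W σ v)
    (A : K →L[ℂ] K) (v : K) :
    Continuous fun σ => W σ (A (star (W σ) v)) := by
  have hg : Continuous fun σ => A (star (W σ) v) :=
    A.continuous.comp (continuous_star_apply hW hc v)
  rw [continuous_iff_continuousAt]
  intro σ₀
  rw [ContinuousAt, tendsto_iff_norm_sub_tendsto_zero]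
  have h1 := tendsto_iff_norm_sub_tendsto_zero.1 (hg.tendsto σ₀)
  have h2 := tendsto_iff_norm_sub_tendsto_zero.1 ((hc (A (star (W σ₀) v))).tendsto σ₀)
  have h3 := h1.add h2
  rw [add_zero] at h3
  refine squeeze_zero (fun _ => norm_nonneg _) (fun σ => ?_) h3
  have : W σ (A (star (W σ) v)) - W σ₀ (A (star (W σ₀) v))
      = W σ (A (star (W σ) v) - A (star (W σ₀) v))
        + (W σ (A (star (W σ₀) v)) - W σ₀ (A (star (W σ₀) v))) := by
    rw [map_sub]; abel
  rw [this]
  refine (norm_add_le _ _).trans ?_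
  gcongr
  exact norm_apply_le_of_mem_unitary (hW σ) _

end Amplification

/-! ### The Hilbert tensor powers

The `N`-fold Hilbert space tensor power of a Hilbert space with orthonormal basis `(ψ_j)_{j ∈ J}` is
realized as `ℓ²(J^N)`: a vector is given by its coordinates with respect to
`ψ_{α₁} ⊗ ⋯ ⊗ ψ_{α_N}`. -/

/-- The space `𝓗_N = 𝓗^{⊗ N}`, for a Hilbert space `𝓗` with an orthonormal basis indexed
by `J`. -/
abbrev HN (J : Type*) (N : ℕ) : Type _ := L2 (Fin N → J)

section Tensor

variable {J H : Type*} [NormedAddCommGroup H] [InnerProductSpace ℂ H]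

theorem hasSum_pi_prod {R : Type*} [NormedCommRing R] [NormOneClass R] [CompleteSpace R] (N : ℕ)
    (a : Fin N → J → R) (ha : ∀ i, Summable fun j => ‖a i j‖) :
    (Summable fun α : Fin N → J => ‖∏ i, a i (α i)‖) ∧
      HasSum (fun α : Fin N → J => ∏ i, a i (α i)) (∏ i, ∑' j, a i j) := by
  induction N with
  | zero => exact ⟨(hasSum_fintype _).summable, by simp⟩
  | succ N ih =>
    obtain ⟨h1, h2⟩ := ih (fun i => a i.succ) fun i => ha i.succ
    set g : (Fin N → J) → R := fun α => ∏ i, a i.succ (α i) with hg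
    have h3 : Summable fun x : J × (Fin N → J) => a 0 x.1 * g x.2 :=
      summable_mul_of_summable_norm (ha 0) h1
    have h4 : Summable fun x : J × (Fin N → J) => ‖a 0 x.1 * g x.2‖ := (ha 0).mul_norm h1
    have hE : ∀ x : J × (Fin N → J), (∏ i, a i ((Fin.consEquiv fun _ => J) x i))
        = a 0 x.1 * g x.2 := fun x => by
      simp [Fin.prod_univ_succ, Fin.consEquiv, hg]
    constructor
    · rw [← (Fin.consEquiv fun _ => J).summable_iff]
      exact h4.congr fun x => by rw [Function.comp_apply, hE]
    · rw [← (Fin.consEquiv fun _ => J).hasSum_iff, Fin.prod_univ_succ]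
      have h5 : HasSum (a 0) (∑' j, a 0 j) := (ha 0).of_norm.hasSum
      have h6 := h5.mul h2 h3
      have h7 : (fun α : Fin (N + 1) → J => ∏ i, a i (α i)) ∘ (Fin.consEquiv fun _ => J)
          = fun x : J × (Fin N → J) => a 0 x.1 * g x.2 := funext hE
      rw [h7]
      exact h6

theorem tprod_mem (ψ : HilbertBasis J ℂ H) {N : ℕ} (φ : Fin N → H) :
    Memℓp (fun α : Fin N → J => ∏ i, ⟪ψ (α i), φ i⟫_ℂ) 2 := by
  rw [memL2_iff]
  have h : ∀ i, Summable fun j => ‖‖⟪ψ j, φ i⟫_ℂ‖ ^ 2‖ := fun i => by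
    have := L2.summable_sq (ψ.repr (φ i))
    simpa [ψ.repr_apply_apply] using this
  refine ((hasSum_pi_prod N (fun i j => ‖⟪ψ j, φ i⟫_ℂ‖ ^ 2) h).2.summable).congr fun α => ?_
  rw [Finset.prod_pow, norm_prod]

/-- The product vector `φ₁ ⊗ ⋯ ⊗ φ_N`. -/
def tprod (ψ : HilbertBasis J ℂ H) {N : ℕ} (φ : Fin N → H) : HN J N :=
  ⟨fun α => ∏ i, ⟪ψ (α i), φ i⟫_ℂ, tprod_mem ψ φ⟩

@[simp] theorem tprod_apply (ψ : HilbertBasis J ℂ H) {N : ℕ} (φ : Fin N → H) (α : Fin N → J) :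
    tprod ψ φ α = ∏ i, ⟪ψ (α i), φ i⟫_ℂ := rfl

/-- The inner product of product vectors; with `basisVec_apply` and multilinearity (immediate from
the definition) it identifies `HN J N` as the Hilbert space tensor power. -/
theorem inner_tprod (ψ : HilbertBasis J ℂ H) {N : ℕ} (φ χ : Fin N → H) :
    ⟪tprod ψ φ, tprod ψ χ⟫_ℂ = ∏ i, ⟪φ i, χ i⟫_ℂ := by
  have h : ∀ i, Summable fun j => ‖⟪φ i, ψ j⟫_ℂ * ⟪ψ j, χ i⟫_ℂ‖ := fun i =>
    (ψ.summable_inner_mul_inner (φ i) (χ i)).norm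
  have h2 := (hasSum_pi_prod N (fun i j => ⟪φ i, ψ j⟫_ℂ * ⟪ψ j, χ i⟫_ℂ) h).2.tsum_eq
  simp_rw [ψ.tsum_inner_mul_inner] at h2
  rw [← h2, lp.inner_eq_tsum]
  refine tsum_congr fun α => ?_
  rw [Finset.prod_mul_distrib, tprod_apply, tprod_apply, RCLike.inner_apply, mul_comm, map_prod]
  simp

/-- The basis vectors `Ψ_α = ψ_{α₁} ⊗ ⋯ ⊗ ψ_{α_N}`. -/
def basisVec (ψ : HilbertBasis J ℂ H) {N : ℕ} (α : Fin N → J) : HN J N :=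
  tprod ψ fun i => ψ (α i)

open Classical in
theorem basisVec_apply (ψ : HilbertBasis J ℂ H) {N : ℕ} (α β : Fin N → J) :
    basisVec ψ α β = if β = α then 1 else 0 := by
  have h : ∀ i, ⟪ψ (β i), ψ (α i)⟫_ℂ = if β i = α i then 1 else 0 := fun i =>
    orthonormal_iff_ite.1 ψ.orthonormal _ _
  simp only [basisVec, tprod_apply, h, Finset.prod_ite_zero, funext_iff]
  simp

end Tensor

/-! ### Operators acting on two of the `N` factors -/

/-- Pairs `(i, j)` with `i < j`. -/
abbrev Pair (N : ℕ) : Type := {p : Fin N × Fin N // p.1 < p.2}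

open Classical in
/-- The identification `J^N ≅ J^{k ≠ i, j} × J²`, the last factor holding the coordinates
`i` and `j`, in this order. -/
def pairEquiv (J : Type*) {N : ℕ} (p : Pair N) :
    ({k : Fin N // k ≠ p.1.1 ∧ k ≠ p.1.2} → J) × (Fin 2 → J) ≃ (Fin N → J) where
  toFun x k := if h1 : k = p.1.1 then x.2 0 else if h2 : k = p.1.2 then x.2 1 else x.1 ⟨k, h1, h2⟩
  invFun α := (fun k => α k.1, ![α p.1.1, α p.1.2])
  left_inv x := by
    have hne : p.1.2 ≠ p.1.1 := p.2.ne'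
    refine Prod.ext ?_ ?_
    · funext k
      simp [k.2.1, k.2.2]
    · funext k
      fin_cases k <;> simp [hne]
  right_inv α := by
    funext k
    by_cases h1 : k = p.1.1
    · simp [h1]
    · by_cases h2 : k = p.1.2
      · subst h2; simp [h1]
      · simp [h1, h2]

/-- For a bounded operator `A` on `𝓗_2`, the operator `A_{i,j}` on `𝓗_N` acting as `A` on the
factors `i` and `j` and trivially on the others. -/
def pairOp {J : Type*} {N : ℕ} (p : Pair N) (A : HN J 2 →L[ℂ] HN J 2) : HN J N →L[ℂ] HN J N :=
  amp (pairEquiv J p) A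

/-- The action of `A_{i,j}` on product vectors, in coordinates. -/
theorem pairOp_tprod {J H : Type*} [NormedAddCommGroup H] [InnerProductSpace ℂ H]
    (ψ : HilbertBasis J ℂ H) {N : ℕ} (p : Pair N) (A : HN J 2 →L[ℂ] HN J 2) (φ : Fin N → H)
    (α : Fin N → J) :
    pairOp p A (tprod ψ φ) α
      = A (tprod ψ ![φ p.1.1, φ p.1.2]) ![α p.1.1, α p.1.2]
        * ∏ k ∈ Finset.univ.erase p.1.1 |>.erase p.1.2, ⟪ψ (α k), φ k⟫_ℂ := by
  have hne : p.1.2 ≠ p.1.1 := p.2.ne'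
  have hs : slice (pairEquiv J p) (tprod ψ φ) (fun k => α k.1)
      = (∏ k ∈ Finset.univ.erase p.1.1 |>.erase p.1.2, ⟪ψ (α k), φ k⟫_ℂ)
        • tprod ψ ![φ p.1.1, φ p.1.2] := by
    ext β
    rw [slice_apply, tprod_apply, lp.coeFn_smul, Pi.smul_apply, tprod_apply, smul_eq_mul,
      Fin.prod_univ_two, ← Finset.mul_prod_erase _ _ (Finset.mem_univ p.1.1),
      ← Finset.mul_prod_erase _ _ (Finset.mem_erase.2 ⟨hne, Finset.mem_univ p.1.2⟩),
      ← mul_assoc, mul_comm]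
    congr 1
    · refine Finset.prod_congr rfl fun k hk => ?_
      simp only [Finset.mem_erase] at hk
      simp [pairEquiv, hk.1, hk.2.1]
    · simp [pairEquiv, hne]
  change A (slice (pairEquiv J p) (tprod ψ φ) (fun k => α k.1)) ![α p.1.1, α p.1.2] = _
  rw [hs, map_smul, lp.coeFn_smul, Pi.smul_apply, smul_eq_mul, mul_comm]

/-- The swap `V (φ ⊗ χ) = χ ⊗ φ` on `𝓗_2`. -/
def swap (J : Type*) : HN J 2 →L[ℂ] HN J 2 :=
  LinearMap.mkContinuous
    { toFun := fun f => ⟨fun β => f (β ∘ Equiv.swap 0 1), memL2_iff.2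
        (((Equiv.swap (0 : Fin 2) 1).arrowCongr (Equiv.refl J)).summable_iff.2
          (L2.summable_sq f))⟩
      map_add' := fun f g => rfl
      map_smul' := fun c f => rfl }
    1 (fun f => by
      refine le_of_sq_le_sq ?_ (by positivity)
      rw [one_mul, L2.norm_sq, L2.norm_sq f]
      exact (((Equiv.swap (0 : Fin 2) 1).arrowCongr (Equiv.refl J)).tsum_eq
        fun β => ‖f β‖ ^ 2).le)

theorem swap_tprod {J H : Type*} [NormedAddCommGroup H] [InnerProductSpace ℂ H]
    (ψ : HilbertBasis J ℂ H) (φ χ : H) : swap J (tprod ψ ![φ, χ]) = tprod ψ ![χ, φ] := by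
  ext β
  change tprod ψ ![φ, χ] (β ∘ Equiv.swap 0 1) = _
  simp [Fin.prod_univ_two, mul_comm]

/-! ### The Hamiltonian -/

/-- The operator `h` has compact resolvent: for some `z`, `h - z` is a bijection from the domain of
`h` onto the whole space, with bounded and compact inverse `R`. -/
def HasCompactResolvent {H : Type*} [NormedAddCommGroup H] [InnerProductSpace ℂ H]
    (h : H →ₗ.[ℂ] H) : Prop :=
  ∃ (z : ℂ) (R : H →L[ℂ] H), IsCompactOperator R ∧
    (∀ x : H, ∃ hx : R x ∈ h.domain, h ⟨R x, hx⟩ - z • R x = x) ∧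
    ∀ y : h.domain, R (h y - z • (y : H)) = y

section Hamiltonian

variable {J : Type*} (e : J → ℝ) (N : ℕ)

/-- The energy `E_α = e_{α₁} + ⋯ + e_{α_N}`. -/
def energy {J : Type*} (e : J → ℝ) {N : ℕ} (α : Fin N → J) : ℝ := ∑ i, e (α i)

/-- The `N`-particle Hamiltonian `H_N = h_1 + ⋯ + h_N`, where `h ψ_j = e_j ψ_j`: the self-adjoint
operator with `H_N Ψ_α = E_α Ψ_α`, on its natural (maximal) domain. -/
def hamiltonian : HN J N →ₗ.[ℂ] HN J N where
  domain :=
    { carrier := {f | Memℓp (fun α => (energy e α : ℂ) * f α) 2}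
      add_mem' := fun {f g} hf hg => by
        have := Memℓp.add hf hg
        refine cast (congrArg (Memℓp · 2) ?_) this
        funext α
        simp [mul_add]
      zero_mem' := by
        have : Memℓp (0 : (Fin N → J) → ℂ) 2 := zero_memℓp
        refine cast (congrArg (Memℓp · 2) ?_) this
        funext α
        simp
      smul_mem' := fun c f hf => by
        have := Memℓp.const_smul hf c
        refine cast (congrArg (Memℓp · 2) ?_) this
        funext α
        simp [mul_left_comm] }
  toFun :=
    { toFun := fun f => ⟨fun α => (energy e α : ℂ) * f.1 α, f.2⟩
      map_add' := fun f g => by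
        ext α
        exact mul_add _ _ _
      map_smul' := fun c f => by ext; simp [mul_left_comm] }

theorem hamiltonian_apply (f : (hamiltonian e N).domain) (α : Fin N → J) :
    hamiltonian e N f α = (energy e α : ℂ) * f.1 α := rfl

/-- On product vectors with factors in the domain of `h`, the operator `hamiltonian e N` is
`h_1 + ⋯ + h_N`. -/
theorem hamiltonian_tprod {J H : Type*} [NormedAddCommGroup H] [InnerProductSpace ℂ H]
    [CompleteSpace H] {h : H →ₗ.[ℂ] H} (hsa : IsSelfAdjoint h) (ψ : HilbertBasis J ℂ H) {e : J → ℝ}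
    (he : ∀ j, ∃ hj : ψ j ∈ h.domain, h ⟨ψ j, hj⟩ = (e j : ℂ) • ψ j) {N : ℕ}
    (φ : Fin N → h.domain) :
    ∃ hφ : tprod ψ (fun i => (φ i : H)) ∈ (hamiltonian e N).domain,
      hamiltonian e N ⟨_, hφ⟩
        = ∑ k, tprod ψ (Function.update (fun i => (φ i : H)) k (h (φ k))) := by
  have hsym : ∀ (j : J) (x : h.domain), ⟪ψ j, h x⟫_ℂ = e j * ⟪ψ j, (x : H)⟫_ℂ := fun j x => by
    obtain ⟨hj, hj2⟩ := he j
    have hfa := LinearPMap.adjoint_isFormalAdjoint (T := h) hsa.dense_domain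
    rw [LinearPMap.isSelfAdjoint_def.1 hsa] at hfa
    have := hfa ⟨ψ j, hj⟩ x
    rw [hj2, inner_smul_left] at this
    simpa using this.symm
  have key : ∀ α : Fin N → J, (energy e α : ℂ) * tprod ψ (fun i => (φ i : H)) α
      = (∑ k, tprod ψ (Function.update (fun i => (φ i : H)) k (h (φ k))) : HN J N) α := fun α => by
    rw [lp.coeFn_sum, Finset.sum_apply, energy, Complex.ofReal_sum, Finset.sum_mul]
    refine Finset.sum_congr rfl fun k _ => ?_
    rw [tprod_apply, tprod_apply, ← Finset.mul_prod_erase _ _ (Finset.mem_univ k),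
      ← Finset.mul_prod_erase _ _ (Finset.mem_univ k), ← mul_assoc]
    congr 1
    · simp [hsym]
    · refine Finset.prod_congr rfl fun i hi => ?_
      rw [Function.update_of_ne (Finset.ne_of_mem_erase hi)]
  refine ⟨?_, ?_⟩
  · change Memℓp (fun α => (energy e α : ℂ) * tprod ψ (fun i => (φ i : H)) α) 2
    rw [funext key]
    exact lp.memℓp _
  · ext α
    rw [hamiltonian_apply]
    exact key α

/-- The energy shell `𝓚_E`: the eigenspace of `H_N` with eigenvalue `E`. -/
def shell (E : ℝ) : Submodule ℂ (HN J N) where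
  carrier := {f | ∃ hf : f ∈ (hamiltonian e N).domain, hamiltonian e N ⟨f, hf⟩ = (E : ℂ) • f}
  add_mem' := by
    rintro f g ⟨hf, hf2⟩ ⟨hg, hg2⟩
    refine ⟨add_mem hf hg, ?_⟩
    rw [smul_add, ← hf2, ← hg2, ← LinearPMap.map_add]
    rfl
  zero_mem' := ⟨zero_mem _, by
    rw [smul_zero]
    exact LinearPMap.map_zero _⟩
  smul_mem' := by
    rintro c f ⟨hf, hf2⟩
    refine ⟨Submodule.smul_mem _ c hf, ?_⟩
    rw [smul_comm, ← hf2, ← LinearPMap.map_smul]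
    rfl

theorem mem_shell_iff (E : ℝ) (f : HN J N) :
    f ∈ shell e N E ↔ ∀ α, (energy e α : ℂ) * f α = (E : ℂ) * f α := by
  constructor
  · rintro ⟨hf, hf2⟩ α
    have := congrArg (fun g : HN J N => g α) hf2
    exact this
  · intro h
    have hf : f ∈ (hamiltonian e N).domain := by
      change Memℓp (fun α => (energy e α : ℂ) * f α) 2
      rw [funext h]
      exact lp.memℓp ((E : ℂ) • f)
    refine ⟨hf, ?_⟩
    ext α
    exact h α

theorem isClosed_shell (E : ℝ) : IsClosed (shell e N E : Set (HN J N)) := by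
  have : (shell e N E : Set (HN J N))
      = ⋂ α, {f : HN J N | (energy e α : ℂ) * f α = (E : ℂ) * f α} := by
    ext f
    simp [mem_shell_iff]
  rw [this]
  refine isClosed_iInter fun α => ?_
  have hc : Continuous fun f : HN J N => f α :=
    (continuous_apply α).comp (lp.uniformContinuous_coe (p := 2)).continuous
  exact isClosed_eq (continuous_const.mul hc) (continuous_const.mul hc)

instance instCompleteSpaceShell (E : ℝ) : CompleteSpace (shell e N E) :=
  (isClosed_shell e N E).completeSpace_coe

/-- `P_E`, the orthogonal projection onto the energy shell `𝓚_E` (it is `0` unless `E` is an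
eigenvalue of `H_N`). -/
def shellProj (E : ℝ) : HN J N →L[ℂ] HN J N := (shell e N E).starProjection

/-- The energy algebra `𝓐_N`: all bounded functions `f(H_N) = ∑_E f(E) P_E` of the Hamiltonian
(the sum converges strongly). -/
def energyAlgebra : Set (HN J N →L[ℂ] HN J N) :=
  {A | ∃ f : ℝ → ℂ, (∃ c : ℝ, ∀ E, ‖f E‖ ≤ c) ∧
    ∀ x, HasSum (fun E : ℝ => f E • shellProj e N E x) (A x)}

end Hamiltonian

/-! ### Collision specifications and the generator -/

/-- A collision specification `(𝓒, U, ν)` for the single-particle energies `(e_j)`. Continuity of `U`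
is with respect to the strong operator topology (so norm continuous `U` are included). -/
structure CollisionSpec {J : Type*} (e : J → ℝ) (C : Type*) [MetricSpace C] [CompactSpace C]
    [MeasurableSpace C] [BorelSpace C] where
  U : C → HN J 2 →L[ℂ] HN J 2
  unitary_U : ∀ σ, U σ ∈ unitary (HN J 2 →L[ℂ] HN J 2)
  continuous_U : ∀ v, Continuous fun σ => U σ v
  injective_U : Function.Injective U
  ν : Measure C
  isProbabilityMeasure : IsProbabilityMeasure ν
  isOpenPosMeasure : ν.IsOpenPosMeasure
  /-- `U(σ)` commutes with `H_2`. -/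
  commutes : ∀ (σ : C) (x : (hamiltonian e 2).domain),
    ∃ hx : U σ x ∈ (hamiltonian e 2).domain, hamiltonian e 2 ⟨U σ x, hx⟩ = U σ (hamiltonian e 2 x)
  exists_one : ∃ σ₀, U σ₀ = 1
  /-- Time reversibility; `τ` is the map `σ ↦ σ'` with `U(σ)^* = U(σ')`. -/
  reversible : ∃ τ : C → C, (∀ σ, star (U σ) = U (τ σ)) ∧ MeasurePreserving τ ν ν
  /-- Exchange symmetry; `τ` is the map `σ ↦ σ'` with `V U(σ) V^* = U(σ')`. -/
  symmetric : ∃ τ : C → C, (∀ σ, swap J * U σ * star (swap J) = U (τ σ)) ∧ MeasurePreserving τ ν ν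

namespace CollisionSpec

variable {J : Type*} {e : J → ℝ} {C : Type*} [MetricSpace C] [CompactSpace C] [MeasurableSpace C]
  [BorelSpace C] (S : CollisionSpec e C)

instance instIsProbabilityMeasure : IsProbabilityMeasure S.ν := S.isProbabilityMeasure

/-- Ergodicity: `{U(σ) : σ ∈ 𝓒}' = 𝓐_2`. -/
def IsErgodic : Prop := Set.centralizer (Set.range S.U) = energyAlgebra e 2

variable {N : ℕ}

/-- `U_{i,j}(σ)` on `𝓗_N`. -/
def pairU (p : Pair N) (σ : C) : HN J N →L[ℂ] HN J N := pairOp p (S.U σ)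

theorem pairU_mem_unitary (p : Pair N) (σ : C) : S.pairU p σ ∈ unitary (HN J N →L[ℂ] HN J N) :=
  amp_mem_unitary _ (S.unitary_U σ)

theorem continuous_conj (p : Pair N) (A : HN J N →L[ℂ] HN J N) (v : HN J N) :
    Continuous fun σ => S.pairU p σ (A (star (S.pairU p σ) v)) :=
  continuous_conj_apply (S.pairU_mem_unitary p)
    (continuous_amp (pairEquiv J p) S.unitary_U S.continuous_U) A v

theorem integrable_conj (p : Pair N) (A : HN J N →L[ℂ] HN J N) (v : HN J N) :
    Integrable (fun σ => S.pairU p σ (A (star (S.pairU p σ) v))) S.ν :=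
  (S.continuous_conj p A v).integrable_of_hasCompactSupport (HasCompactSupport.of_compactSpace _)

/-- `𝒬_{i,j} A = ∫ U_{i,j}(σ) A U_{i,j}(σ)^* dν(σ)`, the integral being taken in the strong operator
topology, i.e. after application to a vector. -/
def pairQ (p : Pair N) (A : HN J N →L[ℂ] HN J N) : HN J N →L[ℂ] HN J N :=
  LinearMap.mkContinuous
    { toFun := fun v => ∫ σ, S.pairU p σ (A (star (S.pairU p σ) v)) ∂S.ν
      map_add' := fun v w => by
        rw [← integral_add (S.integrable_conj p A v) (S.integrable_conj p A w)]
        simp only [map_add]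
      map_smul' := fun c v => by
        rw [RingHom.id_apply, ← integral_smul]
        simp only [map_smul] }
    ‖A‖ (fun v => by
      refine (norm_integral_le_of_norm_le_const (C := ‖A‖ * ‖v‖)
        (Eventually.of_forall fun σ => ?_)).trans (by simp)
      refine (norm_apply_le_of_mem_unitary (S.pairU_mem_unitary p σ) _).trans ?_
      refine (A.le_opNorm _).trans ?_
      gcongr
      exact norm_apply_le_of_mem_unitary (Unitary.star_mem (S.pairU_mem_unitary p σ)) _)

theorem pairQ_apply (p : Pair N) (A : HN J N →L[ℂ] HN J N) (v : HN J N) :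
    S.pairQ p A v = ∫ σ, S.pairU p σ (A (star (S.pairU p σ) v)) ∂S.ν := rfl

/-- `𝒬_N = (N choose 2)⁻¹ ∑_{i<j} 𝒬_{i,j}`. -/
def kacQ (A : HN J N →L[ℂ] HN J N) : HN J N →L[ℂ] HN J N :=
  ((N.choose 2 : ℂ))⁻¹ • ∑ p : Pair N, S.pairQ p A

/-- The quantum Kac generator `ℒ_N = N (𝒬_N - 1)`. -/
def kacGenerator (A : HN J N →L[ℂ] HN J N) : HN J N →L[ℂ] HN J N := (N : ℂ) • (S.kacQ A - A)

/-- The algebra `𝒞_N = {U_{i,j}(σ) : i < j, σ ∈ 𝓒}'`. -/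
def conserved (N : ℕ) : Set (HN J N →L[ℂ] HN J N) :=
  Set.centralizer {W | ∃ (p : Pair N) (σ : C), W = S.pairU p σ}

/-- `P` is a minimal projection of `𝒞_N`. -/
def IsMinimalProjection (P : HN J N →L[ℂ] HN J N) : Prop :=
  P ∈ S.conserved N ∧ IsStarProjection P ∧ P ≠ 0 ∧
    ∀ Q ∈ S.conserved N, IsStarProjection Q → Q ≠ 0 → Q ≤ P → Q = P

end CollisionSpec

/-- A density matrix on `𝓗_N`: a positive trace class operator with trace one. For positive operators
the trace is the sum of the diagonal entries in any orthonormal basis, and trace class means that it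
is finite. -/
def IsDensityMatrix {J H : Type*} [NormedAddCommGroup H] [InnerProductSpace ℂ H]
    (ψ : HilbertBasis J ℂ H) {N : ℕ} (ρ : HN J N →L[ℂ] HN J N) : Prop :=
  ρ.IsPositive ∧ HasSum (fun α : Fin N → J => ⟪basisVec ψ α, ρ (basisVec ψ α)⟫_ℂ) 1

/-- The normalized projection `P / Tr P = P / dim (ran P)`, for `P ≠ 0` of finite rank. -/
def normalizedProj {K : Type*} [NormedAddCommGroup K] [InnerProductSpace ℂ K] (P : K →L[ℂ] K) :
    K →L[ℂ] K :=
  ((Module.finrank ℂ P.range : ℂ))⁻¹ • P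

/-- Adjacency of indices. -/
def Adjacent {J : Type*} (e : J → ℝ) {N : ℕ} (α β : Fin N → J) : Prop :=
  ∃ i j : Fin N, i < j ∧ e (α i) + e (α j) = e (β i) + e (β j) ∧
    ∀ k, k ≠ i → k ≠ j → α k = β k

/-- Equivalence of indices: they are joined by a finite sequence of successively adjacent indices. -/
def Equivalent {J : Type*} (e : J → ℝ) {N : ℕ} : (Fin N → J) → (Fin N → J) → Prop :=
  Relation.ReflTransGen (Adjacent e)

end QKac

end

/-!
On a block of `𝓗_N` in which all particles but `i, j` are frozen, an operator commuting with the
`U_{i,j}(σ)` commutes with the pair collisions, so by ergodicity it is a function of the pair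
energy. Hence `𝒞_N` consists of the operators which are diagonal in the basis `Ψ_α` with eigenvalues
constant under adjacency, and its minimal projections are the projections onto equivalence classes.

A steady state `ϱ` is Hilbert-Schmidt, and it is the average of its conjugates `W ϱ W^*` over the
collisions `W = U_{i,j}(σ)`. All these have the Hilbert-Schmidt norm of `ϱ`, so by strict convexity
they are all equal to `ϱ`, that is, `ϱ ∈ 𝒞_N`.

Compactness of the resolvent makes the eigenvalues of `h` tend to infinity, so that finitely many
indices share a given total energy.
-/

namespace QKac

open MeasureTheory Filter Topology

section CoordProj

variable {ι 𝕜 E : Type*} [RCLike 𝕜] [NormedAddCommGroup E] [InnerProductSpace 𝕜 E]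

theorem ext_hilbertBasis {F : Type*} [TopologicalSpace F] [AddCommMonoid F] [Module 𝕜 F]
    [T2Space F] (b : HilbertBasis ι 𝕜 E) {A B : E →L[𝕜] F} (h : ∀ i, A (b i) = B (b i)) :
    A = B :=
  ContinuousLinearMap.ext_on
    (Submodule.dense_iff_topologicalClosure_eq_top.2 b.dense_span) (by rintro _ ⟨i, rfl⟩; exact h i)

variable [CompleteSpace E] (b : HilbertBasis ι 𝕜 E) {s t : Set ι} {i : ι}

/-- The coordinate projection of a Hilbert basis `b` to a set `s` of indices: the orthogonal
projection onto the closed span of the `b i` with `i ∈ s`. -/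
noncomputable def coordProj (s : Set ι) : E →L[𝕜] E :=
  (Submodule.span 𝕜 (b '' s)).topologicalClosure.starProjection

theorem isStarProjection_coordProj (s : Set ι) : IsStarProjection (coordProj b s) :=
  isStarProjection_starProjection

theorem coordProj_apply_of_mem (hi : i ∈ s) : coordProj b s (b i) = b i :=
  Submodule.starProjection_eq_self_iff.2 <|
    Submodule.le_topologicalClosure _ <| Submodule.subset_span ⟨i, hi, rfl⟩

theorem coordProj_apply_of_notMem (hi : i ∉ s) : coordProj b s (b i) = 0 := by
  rw [coordProj, Submodule.starProjection_apply_eq_zero_iff, Submodule.orthogonal_closure,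
    Submodule.mem_orthogonal]
  intro u hu
  induction hu using Submodule.span_induction with
  | mem _ h =>
    obtain ⟨j, hj, rfl⟩ := h
    exact b.orthonormal.inner_eq_zero (ne_of_mem_of_not_mem hj hi)
  | zero => exact inner_zero_left _
  | add _ _ _ _ hx hy => rw [inner_add_left, hx, hy, add_zero]
  | smul c _ _ hx => rw [inner_smul_left, hx, mul_zero]

theorem coordProj_apply_ne_zero_iff : coordProj b s (b i) ≠ 0 ↔ i ∈ s :=
  ⟨not_imp_comm.1 (coordProj_apply_of_notMem b), fun hi => by
    rw [coordProj_apply_of_mem b hi]; exact b.orthonormal.ne_zero i⟩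

theorem coordProj_le_coordProj_iff : coordProj b s ≤ coordProj b t ↔ s ⊆ t := by
  rw [coordProj, coordProj, Submodule.starProjection_le_starProjection_iff]
  refine ⟨fun h i hi => ?_, fun h =>
    Submodule.topologicalClosure_mono (Submodule.span_mono (Set.image_mono h))⟩
  have hmem := h (Submodule.le_topologicalClosure _ (Submodule.subset_span ⟨i, hi, rfl⟩))
  have hfix : coordProj b t (b i) = b i := Submodule.starProjection_eq_self_iff.2 hmem
  exact (coordProj_apply_ne_zero_iff b).1 (hfix.symm ▸ b.orthonormal.ne_zero i)

theorem coordProj_injective : Function.Injective (coordProj b) := fun _ _ h =>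
  ((coordProj_le_coordProj_iff b).1 h.le).antisymm ((coordProj_le_coordProj_iff b).1 h.ge)

theorem coordProj_ne_zero_iff : coordProj b s ≠ 0 ↔ s.Nonempty := by
  have h0 : coordProj b ∅ = 0 := ext_hilbertBasis b fun i =>
    coordProj_apply_of_notMem b (Set.notMem_empty i)
  rw [← h0, (coordProj_injective b).ne_iff, Set.nonempty_iff_ne_empty]

theorem eq_coordProj_of_isStarProjection {P : E →L[𝕜] E} (hP : IsStarProjection P) {a : ι → 𝕜}
    (ha : ∀ i, P (b i) = a i • b i) : P = coordProj b {i | a i = 1} := by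
  refine ext_hilbertBasis b fun i => ?_
  have hidem : (a i * a i) • b i = a i • b i := by
    have h := DFunLike.congr_fun hP.isIdempotentElem.eq (b i)
    rwa [mul_apply_eq_comp, ha, map_smul, ha, smul_smul] at h
  rcases (IsIdempotentElem.iff_eq_zero_or_one (p := a i)).1
    (smul_left_injective 𝕜 (b.orthonormal.ne_zero i) hidem) with h | h
  · rw [ha, h, zero_smul, coordProj_apply_of_notMem b (by simp [h])]
  · rw [ha, h, one_smul, coordProj_apply_of_mem b h]

theorem coordProj_eq_finsum (hs : s.Finite) :
    coordProj b s = ∑ᶠ i ∈ s, InnerProductSpace.rankOne 𝕜 (b i) (b i) := by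
  classical
  refine ext_hilbertBasis b fun j => ?_
  rw [finsum_mem_eq_finite_toFinset_sum _ hs, sum_apply]
  simp only [InnerProductSpace.rankOne_apply, orthonormal_iff_ite.1 b.orthonormal, ite_smul,
    one_smul, zero_smul, Finset.sum_ite_eq', hs.mem_toFinset]
  split_ifs with hj
  exacts [coordProj_apply_of_mem b hj, coordProj_apply_of_notMem b hj]

theorem range_coordProj (hs : s.Finite) : (coordProj b s).range = Submodule.span 𝕜 (b '' s) := by
  have := FiniteDimensional.span_of_finite 𝕜 (hs.image b)
  rw [coordProj, Submodule.range_starProjection,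
    (Submodule.closed_of_finiteDimensional _).submodule_topologicalClosure_eq]

theorem finiteDimensional_range_coordProj (hs : s.Finite) :
    FiniteDimensional 𝕜 (coordProj b s).range :=
  range_coordProj b hs ▸ FiniteDimensional.span_of_finite 𝕜 (hs.image b)

theorem finrank_range_coordProj (hs : s.Finite) :
    Module.finrank 𝕜 (coordProj b s).range = Nat.card s := by
  have := hs.fintype
  rw [range_coordProj b hs, Set.image_eq_range, Nat.card_eq_fintype_card]
  exact finrank_span_eq_card
    (b.orthonormal.linearIndependent.comp ((↑) : s → ι) Subtype.val_injective)

end CoordProj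

section NormalizedProj

variable {ι E : Type*} [NormedAddCommGroup E] [InnerProductSpace ℂ E] [CompleteSpace E]

open scoped ComplexOrder in
theorem isPositive_normalizedProj {P : E →L[ℂ] E} (hP : IsStarProjection P) :
    (normalizedProj P).IsPositive :=
  (ContinuousLinearMap.IsPositive.of_isStarProjection hP).smul_of_nonneg
    (inv_nonneg.2 (Nat.cast_nonneg _))

theorem norm_normalizedProj_le_one {P : E →L[ℂ] E} (hP : IsStarProjection P) :
    ‖normalizedProj P‖ ≤ 1 := by
  rw [normalizedProj, norm_smul, norm_inv, Complex.norm_natCast]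
  exact mul_le_one₀ (Nat.cast_inv_le_one _) (norm_nonneg _) hP.norm_le

variable (b : HilbertBasis ι ℂ E) {s : Set ι} {i : ι}

theorem normalizedProj_coordProj_apply_of_mem (hs : s.Finite) (hi : i ∈ s) :
    normalizedProj (coordProj b s) (b i) = (Nat.card s : ℂ)⁻¹ • b i := by
  rw [normalizedProj, _root_.smul_apply, coordProj_apply_of_mem b hi, finrank_range_coordProj b hs]

theorem normalizedProj_coordProj_apply_of_notMem (hi : i ∉ s) :
    normalizedProj (coordProj b s) (b i) = 0 := by
  rw [normalizedProj, _root_.smul_apply, coordProj_apply_of_notMem b hi, smul_zero]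

theorem natCard_cast_ne_zero (hs : s.Finite) (hne : s.Nonempty) : (Nat.card s : ℂ) ≠ 0 := by
  have := hs.to_subtype
  have := hne.to_subtype
  exact Nat.cast_ne_zero.2 Nat.card_pos.ne'

theorem hasSum_inner_normalizedProj_coordProj (hs : s.Finite) (hne : s.Nonempty) :
    HasSum (fun i => ⟪b i, normalizedProj (coordProj b s) (b i)⟫_ℂ) 1 := by
  have hdiag : (fun i => ⟪b i, normalizedProj (coordProj b s) (b i)⟫_ℂ)
      = s.indicator fun _ => (Nat.card s : ℂ)⁻¹ := by
    ext i
    by_cases hi : i ∈ s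
    · rw [normalizedProj_coordProj_apply_of_mem b hs hi, inner_smul_right,
        inner_self_eq_norm_sq_to_K, b.orthonormal.1 i, Set.indicator_of_mem hi]
      simp
    · rw [normalizedProj_coordProj_apply_of_notMem b hi, inner_zero_right,
        Set.indicator_of_notMem hi]
  rw [hdiag, ← hasSum_subtype_iff_indicator]
  have := hs.fintype
  have hsum := hasSum_fintype fun _ : s => (Nat.card s : ℂ)⁻¹
  rwa [Finset.sum_const, Finset.card_univ, nsmul_eq_mul, ← Nat.card_eq_fintype_card,
    mul_inv_cancel₀ (natCard_cast_ne_zero hs hne)] at hsum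

theorem hasSum_smul_normalizedProj_fiber {κ : Type*} {c : ι → κ}
    (hc : ∀ k, (c ⁻¹' {k}).Finite) {r : ι → ℝ} (hr0 : ∀ i, 0 ≤ r i) (hr : Summable r)
    (hconst : ∀ i j, c i = c j → r i = r j) {A : E →L[ℂ] E} (hA : ∀ i, A (b i) = (r i : ℂ) • b i) :
    HasSum (fun k => ((∑' i : c ⁻¹' {k}, r i : ℝ) : ℂ) • normalizedProj (coordProj b (c ⁻¹' {k})))
      A := by
  have hsummable : Summable fun k =>
      ((∑' i : c ⁻¹' {k}, r i : ℝ) : ℂ) • normalizedProj (coordProj b (c ⁻¹' {k})) := by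
    refine .of_norm_bounded (hr.hasSum.tsum_fiberwise c).summable fun k => ?_
    have hw : 0 ≤ ∑' i : c ⁻¹' {k}, r i := tsum_nonneg fun i => hr0 i
    rw [norm_smul, Complex.norm_real, Real.norm_of_nonneg hw]
    exact mul_le_of_le_one_right hw (norm_normalizedProj_le_one (isStarProjection_coordProj b _))
  convert hsummable.hasSum
  refine ext_hilbertBasis b fun i => .trans ?_
    (hsummable.hasSum.mapL (ContinuousLinearMap.apply ℂ E (b i))).tsum_eq
  rw [tsum_eq_single (c i)]
  · have hw : ∑' j : c ⁻¹' {c i}, r j = Nat.card (c ⁻¹' {c i}) * r i := by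
      rw [← nsmul_eq_mul, ← tsum_const]
      exact tsum_congr fun j => hconst _ _ j.2
    rw [ContinuousLinearMap.apply_apply, _root_.smul_apply,
      normalizedProj_coordProj_apply_of_mem b (hc _) rfl, smul_smul, hA, hw, Complex.ofReal_mul,
      Complex.ofReal_natCast, mul_right_comm,
      mul_inv_cancel₀ (natCard_cast_ne_zero (hc _) ⟨i, rfl⟩), one_mul]
  · intro k hk
    rw [ContinuousLinearMap.apply_apply, _root_.smul_apply,
      normalizedProj_coordProj_apply_of_notMem b (by simpa using hk.symm), smul_zero]

end NormalizedProj

section HilbertSchmidt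

open scoped ENNReal

variable {ι E : Type*} [NormedAddCommGroup E] [InnerProductSpace ℂ E] (b : HilbertBasis ι ℂ E)

theorem tsum_enorm_sq_inner (x : E) : ∑' i, ‖⟪b i, x⟫_ℂ‖ₑ ^ 2 = ‖x‖ₑ ^ 2 := by
  simp only [← b.repr_apply_apply, ← ofReal_norm, ← ENNReal.ofReal_pow (norm_nonneg _)]
  rw [← b.repr.norm_map x, L2.norm_sq, ENNReal.ofReal_tsum_of_nonneg (fun _ => sq_nonneg _)
    (L2.summable_sq _)]

/-- The squared Hilbert–Schmidt norm of an operator, computed in a Hilbert basis. -/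
noncomputable def hilbertSchmidtSq (A : E →L[ℂ] E) : ℝ≥0∞ := ∑' i, ‖A (b i)‖ₑ ^ 2

variable [CompleteSpace E]

theorem hilbertSchmidtSq_star (A : E →L[ℂ] E) :
    hilbertSchmidtSq b (star A) = hilbertSchmidtSq b A := by
  simp only [hilbertSchmidtSq, ← tsum_enorm_sq_inner b]
  rw [ENNReal.tsum_comm]
  simp only [ContinuousLinearMap.star_eq_adjoint, ContinuousLinearMap.adjoint_inner_right,
    ← ofReal_norm, norm_inner_symm]

theorem hilbertSchmidtSq_unitary_mul {W : E →L[ℂ] E} (hW : W ∈ unitary (E →L[ℂ] E))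
    (A : E →L[ℂ] E) : hilbertSchmidtSq b (W * A) = hilbertSchmidtSq b A := by
  simp only [hilbertSchmidtSq, mul_apply_eq_comp, ← ofReal_norm,
    ContinuousLinearMap.norm_map_of_mem_unitary hW]

theorem hilbertSchmidtSq_conj {W : E →L[ℂ] E} (hW : W ∈ unitary (E →L[ℂ] E)) (A : E →L[ℂ] E) :
    hilbertSchmidtSq b (W * A * star W) = hilbertSchmidtSq b A := by
  rw [← hilbertSchmidtSq_star, star_mul, star_star, star_mul, hilbertSchmidtSq_unitary_mul b hW,
    ← hilbertSchmidtSq_star, star_mul, star_star, star_star, hilbertSchmidtSq_unitary_mul b hW]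

theorem norm_sq_apply_le_of_isPositive {T : E →L[ℂ] E} (hT : T.IsPositive) (v : E) :
    ‖T v‖ ^ 2 ≤ ‖T‖ * (⟪v, T v⟫_ℂ).re := by
  obtain ⟨B, rfl⟩ := CStarAlgebra.nonneg_iff_eq_star_mul_self.1
    ((ContinuousLinearMap.nonneg_iff_isPositive T).2 hT)
  have hB : (⟪v, (star B * B) v⟫_ℂ).re = ‖B v‖ ^ 2 := by
    rw [mul_apply_eq_comp, ContinuousLinearMap.star_eq_adjoint,
      ContinuousLinearMap.adjoint_inner_right, inner_self_eq_norm_sq_to_K]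
    norm_cast
  calc ‖(star B * B) v‖ ^ 2 ≤ (‖star B‖ * ‖B v‖) ^ 2 := by
        gcongr
        exact (star B).le_opNorm (B v)
    _ = ‖star B * B‖ * (⟪v, (star B * B) v⟫_ℂ).re := by
        rw [hB, CStarRing.norm_star_mul_self, norm_star]
        ring

theorem hilbertSchmidtSq_ne_top_of_isPositive {T : E →L[ℂ] E} (hT : T.IsPositive)
    (hsum : Summable fun i => (⟪b i, T (b i)⟫_ℂ).re) : hilbertSchmidtSq b T ≠ ∞ := by
  have h : Summable fun i => ‖T (b i)‖ ^ 2 :=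
    .of_nonneg_of_le (fun _ => sq_nonneg _) (fun i => norm_sq_apply_le_of_isPositive hT (b i))
      (hsum.mul_left ‖T‖)
  simpa only [hilbertSchmidtSq, ← ofReal_norm, ← ENNReal.ofReal_pow (norm_nonneg _)]
    using h.tsum_ofReal_ne_top

end HilbertSchmidt

section Averaging

variable {E : Type*} [NormedAddCommGroup E] [InnerProductSpace ℂ E] [CompleteSpace E]

theorem conj_eq_iff_mul_eq_mul {R : Type*} [Monoid R] [StarMul R] {W A : R} (hW : W ∈ unitary R) :
    W * A * star W = A ↔ W * A = A * W := by
  constructor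
  · intro h
    calc W * A = W * A * (star W * W) := by rw [Unitary.star_mul_self_of_mem hW, mul_one]
      _ = A * W := by rw [← mul_assoc, h]
  · intro h
    rw [h, mul_assoc, Unitary.mul_star_self_of_mem hW, mul_one]

variable {Ω : Type*} [MeasurableSpace Ω] {μ : Measure Ω} [IsFiniteMeasure μ]

theorem lintegral_enorm_sub_sq_add {f : Ω → E} (hf : MemLp f 2 μ) {x : E}
    (hx : ∫ ω, f ω ∂μ = μ.real Set.univ • x) :
    ∫⁻ ω, ‖f ω - x‖ₑ ^ 2 ∂μ + μ Set.univ * ‖x‖ₑ ^ 2 = ∫⁻ ω, ‖f ω‖ₑ ^ 2 ∂μ := by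
  have hfi : Integrable f μ := hf.integrable one_le_two
  have hsq : Integrable (fun ω => ‖f ω‖ ^ 2) μ := hf.norm.integrable_sq
  have hinner : Integrable (fun ω => ⟪x, f ω⟫_ℂ) μ := hfi.const_inner x
  have hcross : ∫ ω, RCLike.re ⟪x, f ω⟫_ℂ ∂μ = μ.real Set.univ * ‖x‖ ^ 2 := by
    rw [integral_re hinner, integral_inner hfi, hx, inner_smul_right_eq_smul,
      RCLike.smul_re, inner_self_eq_norm_sq]
  have hreal : ∫ ω, ‖f ω - x‖ ^ 2 ∂μ + μ.real Set.univ * ‖x‖ ^ 2 = ∫ ω, ‖f ω‖ ^ 2 ∂μ := by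
    have hlinear : Integrable (fun ω => ‖x‖ ^ 2 - 2 * RCLike.re ⟪x, f ω⟫_ℂ) μ :=
      (integrable_const _).sub (hinner.re.const_mul 2)
    simp_rw [norm_sub_rev _ x, norm_sub_sq (𝕜 := ℂ) x]
    rw [integral_add hlinear hsq, integral_sub (integrable_const _) (hinner.re.const_mul 2),
      integral_const_mul, hcross, integral_const, smul_eq_mul]
    ring
  have hlintegral : ∀ {g : Ω → E}, MemLp g 2 μ →
      ∫⁻ ω, ‖g ω‖ₑ ^ 2 ∂μ = ENNReal.ofReal (∫ ω, ‖g ω‖ ^ 2 ∂μ) := fun hg => by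
    rw [ofReal_integral_eq_lintegral_ofReal hg.norm.integrable_sq (.of_forall fun _ => sq_nonneg _)]
    simp only [ENNReal.ofReal_pow (norm_nonneg _), ofReal_norm]
  have hsub : MemLp (fun ω => f ω - x) 2 μ := hf.sub (memLp_const x)
  rw [hlintegral hsub, hlintegral hf, ← hreal, ENNReal.ofReal_add
    (integral_nonneg fun _ => sq_nonneg _) (by positivity), ENNReal.ofReal_mul measureReal_nonneg,
    ofReal_measureReal, ENNReal.ofReal_pow (norm_nonneg _), ofReal_norm]

variable [TopologicalSpace Ω] [OpensMeasurableSpace Ω] [CompactSpace Ω] {ι : Type*}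
  (b : HilbertBasis ι ℂ E) {W : Ω → E →L[ℂ] E} {A : E →L[ℂ] E}

theorem memLp_of_continuous {F : Type*} [NormedAddCommGroup F] {f : Ω → F} (hf : Continuous f)
    (p : ENNReal) : MemLp f p μ :=
  hf.memLp_of_hasCompactSupport (.of_compactSpace f)

theorem tsum_lintegral_enorm_conj_sub_sq_eq_zero (hW : ∀ ω, W ω ∈ unitary (E →L[ℂ] E))
    (hcont : ∀ v, Continuous fun ω => W ω v) (hA : hilbertSchmidtSq b A ≠ ⊤)
    (hmean : ∀ v, ∫ ω, (W ω * A * star (W ω)) v ∂μ = μ.real Set.univ • A v) :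
    ∑' i, ∫⁻ ω, ‖(W ω * A * star (W ω)) (b i) - A (b i)‖ₑ ^ 2 ∂μ = 0 := by
  have hconj : ∀ v, Continuous fun ω => (W ω * A * star (W ω)) v :=
    continuous_conj_apply hW hcont A
  have hle : ∑' i, ∫⁻ ω, ‖(W ω * A * star (W ω)) (b i)‖ₑ ^ 2 ∂μ
      ≤ μ Set.univ * hilbertSchmidtSq b A := by
    refine ENNReal.summable.tsum_le_of_sum_le fun s => ?_
    rw [← lintegral_finsetSum s fun i _ => (hconj (b i)).enorm.measurable.pow_const 2]
    calc ∫⁻ ω, ∑ i ∈ s, ‖(W ω * A * star (W ω)) (b i)‖ₑ ^ 2 ∂μ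
        ≤ ∫⁻ _, hilbertSchmidtSq b A ∂μ := lintegral_mono fun ω =>
          (ENNReal.sum_le_tsum s).trans (hilbertSchmidtSq_conj b (hW ω) A).le
      _ = μ Set.univ * hilbertSchmidtSq b A := by rw [lintegral_const, mul_comm]
  simp_rw [← fun i => lintegral_enorm_sub_sq_add (memLp_of_continuous (hconj (b i)) 2)
    (hmean (b i))] at hle
  rw [ENNReal.tsum_add, ENNReal.tsum_mul_left] at hle
  have hfin : μ Set.univ * hilbertSchmidtSq b A ≠ ⊤ := ENNReal.mul_ne_top (measure_ne_top _ _) hA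
  rwa [← nonpos_iff_eq_zero, ← ENNReal.add_le_add_iff_right hfin, zero_add]

theorem mem_centralizer_of_integral_conj_eq [μ.IsOpenPosMeasure]
    (hW : ∀ ω, W ω ∈ unitary (E →L[ℂ] E)) (hcont : ∀ v, Continuous fun ω => W ω v)
    (hA : hilbertSchmidtSq b A ≠ ⊤)
    (hmean : ∀ v, ∫ ω, (W ω * A * star (W ω)) v ∂μ = μ.real Set.univ • A v) :
    A ∈ Set.centralizer (Set.range W) := by
  rintro _ ⟨ω, rfl⟩
  refine (conj_eq_iff_mul_eq_mul (hW ω)).1 (ext_hilbertBasis b fun i => ?_)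
  have hzero := ENNReal.tsum_eq_zero.1
    (tsum_lintegral_enorm_conj_sub_sq_eq_zero b hW hcont hA hmean) i
  have hdiff : Continuous fun ω => ‖(W ω * A * star (W ω)) (b i) - A (b i)‖ₑ ^ 2 := by
    exact (ENNReal.continuous_pow 2).comp
      ((continuous_conj_apply hW hcont A (b i)).sub continuous_const).enorm
  rw [lintegral_eq_zero_iff hdiff.measurable] at hzero
  simpa [sub_eq_zero] using congrFun ((hdiff.ae_eq_iff_eq μ continuous_zero).1 hzero) ω

end Averaging

section StandardBasis

variable {X Y Z : Type*}

/-- The standard orthonormal basis of `ℓ²(Z)`. On `HN J N` it consists of the vectors `Ψ_α`,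
whatever the basis of the one-particle space; see `basisVec_eq_stdBasis`. -/
noncomputable def stdBasis (Z : Type*) : HilbertBasis Z ℂ (L2 Z) :=
  .ofRepr (LinearIsometryEquiv.refl ℂ (L2 Z))

theorem inner_stdBasis (z : Z) (f : L2 Z) : ⟪stdBasis Z z, f⟫_ℂ = f z :=
  ((stdBasis Z).repr_apply_apply f z).symm

open Classical in
theorem stdBasis_apply (z w : Z) : stdBasis Z z w = if w = z then 1 else 0 := by
  rw [← inner_stdBasis, orthonormal_iff_ite.1 (stdBasis Z).orthonormal]

theorem basisVec_eq_stdBasis {J H : Type*} [NormedAddCommGroup H] [InnerProductSpace ℂ H]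
    (ψ : HilbertBasis J ℂ H) {N : ℕ} (α : Fin N → J) : basisVec ψ α = stdBasis _ α := by
  ext β
  by_cases hβ : β = α <;> simp [basisVec_apply, stdBasis_apply, hβ]

theorem apply_of_forall_stdBasis {A : L2 Z →L[ℂ] L2 Z} {a : Z → ℂ}
    (hA : ∀ z, A (stdBasis Z z) = a z • stdBasis Z z) (f : L2 Z) (w : Z) : A f w = a w * f w := by
  have h : (innerSL ℂ (stdBasis Z w)).comp A = a w • innerSL ℂ (stdBasis Z w) := by
    refine ext_hilbertBasis (stdBasis Z) fun z => ?_
    by_cases hz : w = z <;> simp [hA, inner_stdBasis, stdBasis_apply, hz]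
  simpa [inner_stdBasis] using congrArg (· f) h

/-- `slice E · x` as a bounded operator `ℓ²(Z) → ℓ²(Y)`. Under `ℓ²(Z) ≅ ℓ²(X) ⊗ ℓ²(Y)` it is
`⟨x| ⊗ 1`. -/
noncomputable def sliceCLM (E : X × Y ≃ Z) (x : X) : L2 Z →L[ℂ] L2 Y :=
  LinearMap.mkContinuous
    { toFun := fun f => slice E f x
      map_add' := fun f g => slice_add E f g x
      map_smul' := fun c f => slice_smul E c f x }
    1 fun f => by
      rw [one_mul]
      refine le_of_sq_le_sq ?_ (norm_nonneg f)
      rw [norm_sq_eq_tsum_slice E f]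
      exact (summable_slice E f).le_tsum x fun _ _ => sq_nonneg _

theorem sliceCLM_apply (E : X × Y ≃ Z) (x : X) (f : L2 Z) : sliceCLM E x f = slice E f x := rfl

theorem adjoint_sliceCLM_stdBasis (E : X × Y ≃ Z) (x : X) (y : Y) :
    (sliceCLM E x).adjoint (stdBasis Y y) = stdBasis Z (E (x, y)) := by
  refine ext_inner_right ℂ fun f => ?_
  rw [ContinuousLinearMap.adjoint_inner_left, inner_stdBasis, inner_stdBasis, sliceCLM_apply,
    slice_apply]

theorem amp_adjoint_sliceCLM (E : X × Y ≃ Z) (x : X) (W : L2 Y →L[ℂ] L2 Y) (g : L2 Y) :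
    amp E W ((sliceCLM E x).adjoint g) = (sliceCLM E x).adjoint (W g) := by
  refine ext_inner_right ℂ fun f => ?_
  rw [ContinuousLinearMap.adjoint_inner_left, sliceCLM_apply,
    ← ContinuousLinearMap.adjoint_inner_right (amp E W), ← ContinuousLinearMap.star_eq_adjoint,
    ← amp_star, ContinuousLinearMap.adjoint_inner_left, sliceCLM_apply, slice_amp,
    ContinuousLinearMap.star_eq_adjoint, ContinuousLinearMap.adjoint_inner_right]

/-- The block `(⟨x| ⊗ 1) A (|x'⟩ ⊗ 1)` of an operator on `ℓ²(Z) ≅ ℓ²(X) ⊗ ℓ²(Y)`, an operator on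
`ℓ²(Y)`. -/
noncomputable def block (E : X × Y ≃ Z) (x x' : X) (A : L2 Z →L[ℂ] L2 Z) : L2 Y →L[ℂ] L2 Y :=
  sliceCLM E x ∘L A ∘L (sliceCLM E x').adjoint

theorem block_stdBasis_apply (E : X × Y ≃ Z) (x x' : X) (A : L2 Z →L[ℂ] L2 Z) (y y' : Y) :
    block E x x' A (stdBasis Y y') y = A (stdBasis Z (E (x', y'))) (E (x, y)) := by
  rw [block, ContinuousLinearMap.comp_apply, ContinuousLinearMap.comp_apply,
    adjoint_sliceCLM_stdBasis, sliceCLM_apply, slice_apply]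

theorem block_mem_centralizer (E : X × Y ≃ Z) (x x' : X) {A : L2 Z →L[ℂ] L2 Z}
    {s : Set (L2 Y →L[ℂ] L2 Y)} (hA : A ∈ Set.centralizer (amp E '' s)) :
    block E x x' A ∈ Set.centralizer s := fun W hW => by
  have hcomm : amp E W * A = A * amp E W := hA _ ⟨W, hW, rfl⟩
  ext1 f
  calc W (slice E (A ((sliceCLM E x').adjoint f)) x)
      = slice E ((amp E W * A) ((sliceCLM E x').adjoint f)) x := (slice_amp E W _ x).symm
    _ = slice E (A (amp E W ((sliceCLM E x').adjoint f))) x := by rw [hcomm, mul_apply_eq_comp]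
    _ = slice E (A ((sliceCLM E x').adjoint (W f))) x := by rw [amp_adjoint_sliceCLM]

theorem slice_stdBasis (E : X × Y ≃ Z) (x : X) (y : Y) :
    slice E (stdBasis Z (E (x, y))) x = stdBasis Y y := by
  classical
  ext y'
  simp [stdBasis_apply]

theorem slice_stdBasis_of_ne (E : X × Y ≃ Z) {x x' : X} (hx : x' ≠ x) (y : Y) :
    slice E (stdBasis Z (E (x, y))) x' = 0 := by
  classical
  ext y'
  simp [stdBasis_apply, hx]

end StandardBasis

section EnergyShell

variable {J : Type*} (e : J → ℝ) {N : ℕ} (α : Fin N → J)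

theorem stdBasis_mem_shell : stdBasis _ α ∈ shell e N (energy e α) := by
  classical
  refine (mem_shell_iff e N _ _).2 fun β => ?_
  by_cases hβ : β = α <;> simp [stdBasis_apply, hβ]

variable {e} in
theorem apply_eq_zero_of_mem_shell {E : ℝ} {f : HN J N} (hf : f ∈ shell e N E)
    (hα : energy e α ≠ E) : f α = 0 := by
  have h := (mem_shell_iff e N E f).1 hf α
  by_contra h0
  exact hα (Complex.ofReal_injective (mul_right_cancel₀ h0 h))

theorem shellProj_stdBasis : shellProj e N (energy e α) (stdBasis _ α) = stdBasis _ α :=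
  Submodule.starProjection_eq_self_iff.2 (stdBasis_mem_shell e α)

theorem shellProj_stdBasis_of_ne {E : ℝ} (hE : E ≠ energy e α) :
    shellProj e N E (stdBasis _ α) = 0 := by
  rw [shellProj, Submodule.starProjection_apply_eq_zero_iff, Submodule.mem_orthogonal']
  intro f hf
  rw [inner_stdBasis, apply_eq_zero_of_mem_shell α hf hE.symm]

theorem exists_apply_stdBasis_of_mem_energyAlgebra {A : HN J N →L[ℂ] HN J N}
    (hA : A ∈ energyAlgebra e N) :
    ∃ f : ℝ → ℂ, ∀ α, A (stdBasis _ α) = f (energy e α) • stdBasis _ α := by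
  obtain ⟨f, -, hf⟩ := hA
  refine ⟨f, fun α => (hf (stdBasis _ α)).unique ?_⟩
  convert hasSum_single (energy e α) fun E hE => ?_
  · rw [shellProj_stdBasis]
  · rw [shellProj_stdBasis_of_ne e α hE, smul_zero]

end EnergyShell

section Indices

variable {J : Type*} {e : J → ℝ} {N : ℕ} {α β : Fin N → J}

theorem pairEquiv_symm_fst_eq_iff (p : Pair N) :
    ((pairEquiv J p).symm α).1 = ((pairEquiv J p).symm β).1 ↔
      ∀ k, k ≠ p.1.1 → k ≠ p.1.2 → α k = β k :=
  ⟨fun h k h1 h2 => congrFun h ⟨k, h1, h2⟩, fun h => funext fun k => h k k.2.1 k.2.2⟩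

theorem energy_pairEquiv_symm_snd (p : Pair N) :
    energy e ((pairEquiv J p).symm α).2 = e (α p.1.1) + e (α p.1.2) :=
  Fin.sum_univ_two _

theorem adjacent_iff : Adjacent e α β ↔ ∃ p : Pair N,
    ((pairEquiv J p).symm α).1 = ((pairEquiv J p).symm β).1 ∧
      energy e ((pairEquiv J p).symm α).2 = energy e ((pairEquiv J p).symm β).2 := by
  simp only [pairEquiv_symm_fst_eq_iff, energy_pairEquiv_symm_snd, Adjacent, Subtype.exists,
    Prod.exists, and_comm, exists_prop]

theorem Adjacent.symm (h : Adjacent e α β) : Adjacent e β α := by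
  obtain ⟨i, j, hij, henergy, hrest⟩ := h
  exact ⟨i, j, hij, henergy.symm, fun k hi hj => (hrest k hi hj).symm⟩

theorem Equivalent.symm (h : Equivalent e α β) : Equivalent e β α :=
  have : Std.Symm (Adjacent e (N := N)) := ⟨fun _ _ => Adjacent.symm⟩
  Relation.ReflTransGen.stdSymm.symm _ _ h

theorem Adjacent.energy_eq (h : Adjacent e α β) : energy e α = energy e β := by
  obtain ⟨i, j, hij, henergy, hrest⟩ := h
  rw [energy, energy, ← Finset.sum_add_sum_compl {i, j},
    ← Finset.sum_add_sum_compl {i, j} fun k => e (β k), Finset.sum_pair hij.ne,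
    Finset.sum_pair hij.ne, henergy]
  congr 1
  refine Finset.sum_congr rfl fun k hk => ?_
  simp only [Finset.mem_compl, Finset.mem_insert, Finset.mem_singleton, not_or] at hk
  rw [hrest k hk.1 hk.2]

theorem Equivalent.apply_eq {R : Type*} {a : (Fin N → J) → R}
    (ha : ∀ α β, Adjacent e α β → a α = a β) (h : Equivalent e α β) : a α = a β := by
  induction h with
  | refl => rfl
  | tail _ hadj ih => exact ih.trans (ha _ _ hadj)

variable (e) in
/-- The equivalence class of the index `α`. -/
def indexClass (α : Fin N → J) : Set (Fin N → J) := {β | Equivalent e α β}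

theorem mem_indexClass_self : α ∈ indexClass e α := Relation.ReflTransGen.refl

theorem Equivalent.indexClass_eq (h : Equivalent e α β) : indexClass e α = indexClass e β :=
  Set.ext fun _ => ⟨h.symm.trans, h.trans⟩

theorem exists_pair_pairEquiv_symm_snd_ne (hN : 2 ≤ N) (h : α ≠ β) :
    ∃ p : Pair N, ((pairEquiv J p).symm α).2 ≠ ((pairEquiv J p).symm β).2 := by
  obtain ⟨k, hk⟩ := Function.ne_iff.1 h
  obtain ⟨l, hl⟩ : ∃ l, l ≠ k := by
    have : Nontrivial (Fin N) := Fin.nontrivial_iff_two_le.2 hN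
    exact exists_ne k
  rcases hl.lt_or_gt with hlt | hlt
  · exact ⟨⟨(l, k), hlt⟩, fun h => hk (congrFun h 1)⟩
  · exact ⟨⟨(k, l), hlt⟩, fun h => hk (congrFun h 0)⟩

end Indices

section Conserved

variable {J : Type*} {e : J → ℝ} {C : Type*} [MetricSpace C] [CompactSpace C] [MeasurableSpace C]
  [BorelSpace C] (S : CollisionSpec e C) {N : ℕ} {A : HN J N →L[ℂ] HN J N}

namespace CollisionSpec

theorem U_mem_shell (σ : C) {E : ℝ} {f : HN J 2} (hf : f ∈ shell e 2 E) :
    S.U σ f ∈ shell e 2 E := by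
  obtain ⟨hdom, hH⟩ := hf
  obtain ⟨hdom', hH'⟩ := S.commutes σ ⟨f, hdom⟩
  exact ⟨hdom', by rw [hH', hH, map_smul]⟩

theorem adjacent_of_pairU_stdBasis_ne_zero {p : Pair N} {σ : C} {α β : Fin N → J}
    (h : S.pairU p σ (stdBasis _ α) β ≠ 0) : Adjacent e β α := by
  obtain ⟨⟨x, y⟩, rfl⟩ := (pairEquiv J p).surjective α
  rw [pairU, pairOp, amp_apply] at h
  have hx : ((pairEquiv J p).symm β).1 = x := by
    by_contra hx
    rw [slice_stdBasis_of_ne _ hx, map_zero] at h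
    exact h rfl
  rw [hx, slice_stdBasis] at h
  refine adjacent_iff.2 ⟨p, ?_, ?_⟩
  · rw [Equiv.symm_apply_apply, hx]
  · rw [Equiv.symm_apply_apply]
    by_contra henergy
    exact h (apply_eq_zero_of_mem_shell _ (S.U_mem_shell σ (stdBasis_mem_shell e y)) henergy)

theorem mem_conserved_of_forall_stdBasis {a : (Fin N → J) → ℂ}
    (hA : ∀ α, A (stdBasis _ α) = a α • stdBasis _ α)
    (ha : ∀ α β, Adjacent e α β → a α = a β) : A ∈ S.conserved N := by
  rintro _ ⟨p, σ, rfl⟩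
  refine ext_hilbertBasis (stdBasis _) fun α => ?_
  ext β
  rw [mul_apply_eq_comp, mul_apply_eq_comp, hA, map_smul, apply_of_forall_stdBasis hA,
    lp.coeFn_smul, Pi.smul_apply, smul_eq_mul]
  by_cases h : S.pairU p σ (stdBasis _ α) β = 0
  · rw [h, mul_zero, mul_zero]
  · rw [ha β α (S.adjacent_of_pairU_stdBasis_ne_zero h)]

variable {S}

theorem IsErgodic.exists_apply_eq_of_mem_conserved (hS : S.IsErgodic) (hA : A ∈ S.conserved N)
    (p : Pair N) (x x' : {k : Fin N // k ≠ p.1.1 ∧ k ≠ p.1.2} → J) :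
    ∃ f : ℝ → ℂ, ∀ α β, ((pairEquiv J p).symm α).1 = x' → ((pairEquiv J p).symm β).1 = x →
      A (stdBasis _ α) β = f (energy e ((pairEquiv J p).symm α).2) *
        stdBasis _ ((pairEquiv J p).symm α).2 ((pairEquiv J p).symm β).2 := by
  have hblock : block (pairEquiv J p) x x' A ∈ energyAlgebra e 2 := by
    rw [← hS]
    refine block_mem_centralizer _ x x' fun W hW => ?_
    obtain ⟨_, ⟨σ, rfl⟩, rfl⟩ := hW
    exact hA _ ⟨p, σ, rfl⟩
  obtain ⟨f, hf⟩ := exists_apply_stdBasis_of_mem_energyAlgebra e hblock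
  refine ⟨f, fun α β hα hβ => ?_⟩
  rw [← smul_eq_mul, ← Pi.smul_apply, ← lp.coeFn_smul, ← hf, block_stdBasis_apply, ← hα, ← hβ,
    Prod.mk.eta, Prod.mk.eta, Equiv.apply_symm_apply, Equiv.apply_symm_apply]

theorem IsErgodic.mem_conserved_iff (hS : S.IsErgodic) (hN : 2 ≤ N) :
    A ∈ S.conserved N ↔ ∃ a : (Fin N → J) → ℂ, (∀ α, A (stdBasis _ α) = a α • stdBasis _ α) ∧
      ∀ α β, Adjacent e α β → a α = a β := by
  classical
  refine ⟨fun hA => ⟨fun α => A (stdBasis _ α) α, fun α => ?_, fun α β h => ?_⟩,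
    fun ⟨a, hdiag, ha⟩ => S.mem_conserved_of_forall_stdBasis hdiag ha⟩
  · ext β
    rw [lp.coeFn_smul, Pi.smul_apply, smul_eq_mul]
    rcases eq_or_ne β α with rfl | hβ
    · simp [stdBasis_apply]
    obtain ⟨p, hp⟩ := exists_pair_pairEquiv_symm_snd_ne hN hβ
    obtain ⟨f, hf⟩ := hS.exists_apply_eq_of_mem_conserved hA p
      ((pairEquiv J p).symm β).1 ((pairEquiv J p).symm α).1
    rw [hf α β rfl rfl, stdBasis_apply, stdBasis_apply, if_neg hp, if_neg hβ, mul_zero, mul_zero]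
  · obtain ⟨p, hx, henergy⟩ := adjacent_iff.1 h
    obtain ⟨f, hf⟩ := hS.exists_apply_eq_of_mem_conserved hA p
      ((pairEquiv J p).symm α).1 ((pairEquiv J p).symm α).1
    have hentry : ∀ γ, ((pairEquiv J p).symm γ).1 = ((pairEquiv J p).symm α).1 →
        A (stdBasis _ γ) γ = f (energy e ((pairEquiv J p).symm γ).2) := fun γ hγ => by
      rw [hf γ γ hγ hγ, stdBasis_apply, if_pos rfl, mul_one]
    exact (hentry α rfl).trans ((congrArg f henergy).trans (hentry β hx.symm).symm)

end CollisionSpec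

end Conserved

section CompactResolvent

theorem tendsto_apply_cofinite_of_isCompactOperator {ι 𝕜 E F : Type*} [RCLike 𝕜]
    [NormedAddCommGroup E] [InnerProductSpace 𝕜 E] [CompleteSpace E] [NormedAddCommGroup F]
    [InnerProductSpace 𝕜 F] [CompleteSpace F] {R : E →L[𝕜] F} (hR : IsCompactOperator R)
    {v : ι → E} (hv : Orthonormal 𝕜 v) : Tendsto (fun i => R (v i)) cofinite (𝓝 0) := by
  obtain ⟨K, hK, hRK⟩ :=
    IsCompactOperator.image_closedBall_subset_compact (f := (R : E →ₗ[𝕜] F)) hR 1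
  have hmem : ∀ i, R (v i) ∈ K := fun i =>
    hRK ⟨v i, mem_closedBall_zero_iff.2 (hv.1 i).le, rfl⟩
  refine hK.tendsto_nhds_of_unique_mapClusterPt (.of_forall hmem) fun y _ hy => ?_
  have hweak : Tendsto (fun i => inner 𝕜 (R (v i)) y) cofinite (𝓝 0) := by
    simp_rw [← ContinuousLinearMap.adjoint_inner_right]
    rw [tendsto_zero_iff_norm_tendsto_zero]
    simpa using (hv.inner_products_summable (R.adjoint y)).tendsto_cofinite_zero.sqrt
  have hinner : MapClusterPt (inner 𝕜 y y) cofinite fun i => inner 𝕜 (R (v i)) y :=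
    hy.continuousAt_comp (f := fun x => inner 𝕜 x y) (by fun_prop)
  exact inner_self_eq_zero.1
    (eq_of_nhds_neBot (NeBot.mono hinner (inf_le_inf_left _ hweak)))

variable {H : Type*} [NormedAddCommGroup H] [InnerProductSpace ℂ H] [CompleteSpace H]
  {h : H →ₗ.[ℂ] H} {J : Type*} {v : J → H} {e : J → ℝ}

theorem HasCompactResolvent.tendsto_abs_cofinite (hres : HasCompactResolvent h)
    (hv : Orthonormal ℂ v)
    (he : ∀ j, ∃ hj : v j ∈ h.domain, h ⟨v j, hj⟩ = (e j : ℂ) • v j) :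
    Tendsto (fun j => |e j|) cofinite atTop := by
  obtain ⟨z, R, hR, -, hleft⟩ := hres
  have hone : ∀ j, ‖(e j : ℂ) - z‖ * ‖R (v j)‖ = 1 := fun j => by
    obtain ⟨hj, hej⟩ := he j
    have hRv : ((e j : ℂ) - z) • R (v j) = v j := by
      rw [← map_smul, sub_smul, ← hej]
      exact hleft ⟨v j, hj⟩
    rw [← norm_smul, hRv, hv.1 j]
  have hnorm : ∀ j, ‖R (v j)‖⁻¹ = ‖(e j : ℂ) - z‖ := fun j =>
    (eq_inv_of_mul_eq_one_left (hone j)).symm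
  have hpos : ∀ j, 0 < ‖R (v j)‖ := fun j =>
    (norm_nonneg _).lt_of_ne' (right_ne_zero_of_mul_eq_one (hone j))
  have hlim : Tendsto (fun j => ‖(e j : ℂ) - z‖) cofinite atTop := by
    simp_rw [← hnorm]
    refine Tendsto.inv_tendsto_nhdsGT_zero (tendsto_nhdsWithin_iff.2 ⟨?_, .of_forall hpos⟩)
    simpa using (tendsto_apply_cofinite_of_isCompactOperator hR hv).norm
  refine tendsto_atTop_mono (fun j => ?_) (tendsto_atTop_add_const_right _ (-‖z‖) hlim)
  have htri := norm_sub_le (e j : ℂ) z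
  rw [Complex.norm_real, Real.norm_eq_abs] at htri
  linarith

theorem HasCompactResolvent.finite_setOf_le (hres : HasCompactResolvent h)
    (hv : Orthonormal ℂ v)
    (he : ∀ j, ∃ hj : v j ∈ h.domain, h ⟨v j, hj⟩ = (e j : ℂ) • v j)
    (hbdd : BddBelow (Set.range e)) (c : ℝ) : {j | e j ≤ c}.Finite := by
  obtain ⟨m, hm⟩ := hbdd
  have hlarge := (hres.tendsto_abs_cofinite hv he).eventually_gt_atTop (max |m| |c|)
  refine (eventually_cofinite.1 hlarge).subset fun j hj => not_lt.2 ?_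
  exact abs_le_max_abs_abs (hm ⟨j, rfl⟩) hj

end CompactResolvent

theorem finite_indexClass {J : Type*} {e : J → ℝ} (hbdd : BddBelow (Set.range e))
    (hfin : ∀ c, {j | e j ≤ c}.Finite) {N : ℕ} (α₀ : Fin N → J) : (indexClass e α₀).Finite := by
  obtain ⟨m, hm⟩ := hbdd
  refine (Set.Finite.pi' fun _ : Fin N => hfin (energy e α₀ - N * m + m)).subset fun α hα i => ?_
  have henergy : energy e α₀ = energy e α :=
    Equivalent.apply_eq (fun _ _ => Adjacent.energy_eq) hα
  have hsingle : e (α i) - m ≤ ∑ k, (e (α k) - m) :=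
    Finset.single_le_sum (f := fun k => e (α k) - m)
      (fun k _ => sub_nonneg.2 (hm ⟨α k, rfl⟩)) (Finset.mem_univ i)
  rw [Finset.sum_sub_distrib, Finset.sum_const, Finset.card_univ, Fintype.card_fin, nsmul_eq_mul]
    at hsingle
  change e (α i) ≤ _
  rw [henergy, energy]
  linarith

section MinimalProjections

variable {J : Type*} {e : J → ℝ} {C : Type*} [MetricSpace C] [CompactSpace C] [MeasurableSpace C]
  [BorelSpace C] {S : CollisionSpec e C} {N : ℕ} {P : HN J N →L[ℂ] HN J N}

namespace CollisionSpec

variable (S) in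
theorem coordProj_mem_conserved {s : Set (Fin N → J)}
    (hs : ∀ α β, Adjacent e α β → (α ∈ s ↔ β ∈ s)) :
    coordProj (stdBasis (Fin N → J)) s ∈ S.conserved N := by
  classical
  refine S.mem_conserved_of_forall_stdBasis (a := fun α => if α ∈ s then 1 else 0)
    (fun α => ?_) fun α β h => by simp only [hs α β h]
  split_ifs with hα
  · rw [coordProj_apply_of_mem _ hα, one_smul]
  · rw [coordProj_apply_of_notMem _ hα, zero_smul]

theorem IsErgodic.exists_eq_coordProj (hS : S.IsErgodic) (hN : 2 ≤ N) (hPc : P ∈ S.conserved N)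
    (hP : IsStarProjection P) : ∃ s : Set (Fin N → J), P = coordProj (stdBasis _) s ∧
      ∀ α ∈ s, indexClass e α ⊆ s := by
  obtain ⟨a, hdiag, ha⟩ := (hS.mem_conserved_iff hN).1 hPc
  exact ⟨{α | a α = 1}, eq_coordProj_of_isStarProjection _ hP hdiag,
    fun α hα β hβ => (Equivalent.apply_eq ha hβ).symm.trans hα⟩

theorem IsErgodic.isMinimalProjection_iff (hS : S.IsErgodic) (hN : 2 ≤ N) :
    S.IsMinimalProjection P ↔ ∃ α, P = coordProj (stdBasis _) (indexClass e α) := by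
  have hclass : ∀ α : Fin N → J, coordProj (stdBasis _) (indexClass e α) ∈ S.conserved N :=
    fun α => S.coordProj_mem_conserved fun β γ h =>
      ⟨fun hβ => hβ.tail h, fun hγ => hγ.tail h.symm⟩
  constructor
  · rintro ⟨hPc, hP, hP0, hmin⟩
    obtain ⟨s, rfl, hs⟩ := hS.exists_eq_coordProj hN hPc hP
    obtain ⟨α, hα⟩ := (coordProj_ne_zero_iff _).1 hP0
    exact ⟨α, (hmin _ (hclass α) (isStarProjection_coordProj _ _)
      ((coordProj_ne_zero_iff _).2 ⟨α, mem_indexClass_self⟩)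
      ((coordProj_le_coordProj_iff _).2 (hs α hα))).symm⟩
  · rintro ⟨α, rfl⟩
    refine ⟨hclass α, isStarProjection_coordProj _ _,
      (coordProj_ne_zero_iff _).2 ⟨α, mem_indexClass_self⟩, fun Q hQc hQ hQ0 hle => ?_⟩
    obtain ⟨t, rfl, ht⟩ := hS.exists_eq_coordProj hN hQc hQ
    obtain ⟨β, hβ⟩ := (coordProj_ne_zero_iff _).1 hQ0
    have hsub : t ⊆ indexClass e α := (coordProj_le_coordProj_iff _).1 hle
    have hsup : indexClass e α ⊆ t := by
      rw [Equivalent.indexClass_eq (hsub hβ)]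
      exact ht β hβ
    rw [hsub.antisymm hsup]

end CollisionSpec

end MinimalProjections

section KacGenerator

variable {J : Type*} {e : J → ℝ} {C : Type*} [MetricSpace C] [CompactSpace C] [MeasurableSpace C]
  [BorelSpace C] (S : CollisionSpec e C) {N : ℕ} {A : HN J N →L[ℂ] HN J N}

theorem card_pair (N : ℕ) : Fintype.card (Pair N) = N.choose 2 := by
  rw [Fintype.card_subtype, Fintype.card_product_filter_lt, Fintype.card_fin]

theorem isOpenPosMeasure_count {X : Type*} [TopologicalSpace X] [MeasurableSpace X]
    [MeasurableSingletonClass X] : (Measure.count : Measure X).IsOpenPosMeasure :=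
  ⟨fun _ _ => Measure.count_ne_zero⟩

namespace CollisionSpec

theorem kacGenerator_eq_zero_iff (hN : 2 ≤ N) :
    S.kacGenerator A = 0 ↔ ∑ p : Pair N, S.pairQ p A = (N.choose 2 : ℂ) • A := by
  have hN0 : (N : ℂ) ≠ 0 := Nat.cast_ne_zero.2 (by omega)
  have hchoose : (N.choose 2 : ℂ) ≠ 0 := Nat.cast_ne_zero.2 (Nat.choose_pos hN).ne'
  rw [kacGenerator, smul_eq_zero_iff_right hN0, sub_eq_zero, kacQ, inv_smul_eq_iff₀ hchoose]

theorem kacGenerator_eq_zero_of_mem_conserved (hN : 2 ≤ N) (hA : A ∈ S.conserved N) :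
    S.kacGenerator A = 0 := by
  have hfix : ∀ p, S.pairQ p A = A := fun p => by
    ext1 v
    have hconj : ∀ σ, S.pairU p σ (A (star (S.pairU p σ) v)) = A v := fun σ =>
      DFunLike.congr_fun
        ((conj_eq_iff_mul_eq_mul (S.pairU_mem_unitary p σ)).2 (hA _ ⟨p, σ, rfl⟩)) v
    simp only [S.pairQ_apply, hconj, integral_const, probReal_univ, one_smul]
  rw [S.kacGenerator_eq_zero_iff hN, Fintype.sum_congr _ _ hfix, Finset.sum_const,
    Finset.card_univ, card_pair, Nat.cast_smul_eq_nsmul]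

/-- The law, up to normalization, of a collision between a random pair of particles. -/
noncomputable def collisionMeasure (N : ℕ) : Measure (Pair N × C) := Measure.count.prod S.ν

instance : IsFiniteMeasure (S.collisionMeasure N) :=
  inferInstanceAs (IsFiniteMeasure (Measure.count.prod S.ν))

instance : (S.collisionMeasure N).IsOpenPosMeasure :=
  have := isOpenPosMeasure_count (X := Pair N)
  have := S.isOpenPosMeasure
  inferInstanceAs (Measure.count.prod S.ν).IsOpenPosMeasure

theorem collisionMeasure_real_univ : (S.collisionMeasure N).real Set.univ = N.choose 2 := by
  rw [collisionMeasure, ← Set.univ_prod_univ, measureReal_prod_prod, Measure.count_real_univ,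
    probReal_univ (μ := S.ν), mul_one, Nat.card_eq_fintype_card, card_pair]

theorem integral_collisionMeasure (v : HN J N) :
    ∫ ω, (S.pairU ω.1 ω.2 * A * star (S.pairU ω.1 ω.2)) v ∂S.collisionMeasure N =
      (∑ p, S.pairQ p A) v := by
  have hcont : Continuous fun ω : Pair N × C =>
      (S.pairU ω.1 ω.2 * A * star (S.pairU ω.1 ω.2)) v :=
    continuous_prod_of_discrete_left.2 fun p => S.continuous_conj p A v
  rw [collisionMeasure, integral_prod _ (memLp_one_iff_integrable.1 (memLp_of_continuous hcont 1)),
    integral_count, sum_apply]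
  rfl

theorem mem_conserved_of_kacGenerator_eq_zero {ι : Type*} (b : HilbertBasis ι ℂ (HN J N))
    (hN : 2 ≤ N) (hA : hilbertSchmidtSq b A ≠ ⊤) (h0 : S.kacGenerator A = 0) :
    A ∈ S.conserved N := by
  have hmean : ∀ v, ∫ ω, (S.pairU ω.1 ω.2 * A * star (S.pairU ω.1 ω.2)) v ∂S.collisionMeasure N =
      (S.collisionMeasure N).real Set.univ • A v := fun v => by
    rw [integral_collisionMeasure, (S.kacGenerator_eq_zero_iff hN).1 h0,
      collisionMeasure_real_univ, Nat.cast_smul_eq_nsmul ℝ, _root_.smul_apply,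
      Nat.cast_smul_eq_nsmul ℂ]
  have hcomm := mem_centralizer_of_integral_conj_eq b
    (W := fun ω : Pair N × C => S.pairU ω.1 ω.2) (fun ω => S.pairU_mem_unitary ω.1 ω.2)
    (fun v => continuous_prod_of_discrete_left.2 fun p =>
      continuous_amp (pairEquiv J p) S.unitary_U S.continuous_U v) hA hmean
  rintro _ ⟨p, σ, rfl⟩
  exact hcomm _ ⟨(p, σ), rfl⟩

theorem smul_mem_conserved (c : ℂ) (hA : A ∈ S.conserved N) : c • A ∈ S.conserved N :=
  fun W hW => by rw [mul_smul_comm, smul_mul_assoc, hA W hW]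

theorem mem_conserved_of_hasSum {ι : Type*} {f : ι → HN J N →L[ℂ] HN J N}
    (hf : ∀ i, f i ∈ S.conserved N) (h : HasSum f A) : A ∈ S.conserved N := fun W hW => by
  have hleft : HasSum (fun i => f i * W) (W * A) := by
    simpa only [hf _ W hW] using h.mul_left W
  exact hleft.unique (h.mul_right W)

end CollisionSpec

end KacGenerator

section SteadyStates

variable {J H : Type*} [NormedAddCommGroup H] [InnerProductSpace ℂ H] {ψ : HilbertBasis J ℂ H}
  {N : ℕ} {ρ : HN J N →L[ℂ] HN J N}

theorem isDensityMatrix_iff : IsDensityMatrix ψ ρ ↔ ρ.IsPositive ∧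
    HasSum (fun α => ⟪stdBasis (Fin N → J) α, ρ (stdBasis _ α)⟫_ℂ) 1 := by
  simp only [IsDensityMatrix, basisVec_eq_stdBasis]

theorem isDensityMatrix_normalizedProj_coordProj (ψ : HilbertBasis J ℂ H) {s : Set (Fin N → J)}
    (hs : s.Finite) (hne : s.Nonempty) :
    IsDensityMatrix ψ (normalizedProj (coordProj (stdBasis _) s)) :=
  isDensityMatrix_iff.2 ⟨isPositive_normalizedProj (isStarProjection_coordProj _ _),
    hasSum_inner_normalizedProj_coordProj _ hs hne⟩

theorem IsDensityMatrix.hilbertSchmidtSq_ne_top (hρ : IsDensityMatrix ψ ρ) :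
    hilbertSchmidtSq (stdBasis _) ρ ≠ ⊤ := by
  obtain ⟨hpos, htr⟩ := isDensityMatrix_iff.1 hρ
  exact hilbertSchmidtSq_ne_top_of_isPositive _ hpos (Complex.hasSum_re htr).summable

theorem IsDensityMatrix.exists_real_diagonal (hρ : IsDensityMatrix ψ ρ) {a : (Fin N → J) → ℂ}
    (ha : ∀ α, ρ (stdBasis _ α) = a α • stdBasis _ α) :
    ∃ r : (Fin N → J) → ℝ, (∀ α, 0 ≤ r α) ∧ HasSum r 1 ∧ ∀ α, a α = r α := by
  obtain ⟨hpos, htr⟩ := isDensityMatrix_iff.1 hρ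
  have hentry : ∀ α, ⟪stdBasis (Fin N → J) α, ρ (stdBasis _ α)⟫_ℂ = a α := fun α => by
    rw [ha, inner_smul_right, inner_self_eq_norm_sq_to_K, (stdBasis _).orthonormal.1]
    simp
  simp_rw [hentry] at htr
  refine ⟨fun α => (a α).re, fun α => ?_, Complex.hasSum_re htr, fun α => ?_⟩ <;>
    simp only [← hentry]
  · exact hpos.re_inner_nonneg_right _
  · exact (hpos.isSymmetric.coe_re_inner_self_apply _).symm

variable {e : J → ℝ} {C : Type*} [MetricSpace C] [CompactSpace C] [MeasurableSpace C]
  [BorelSpace C] {S : CollisionSpec e C}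

namespace CollisionSpec

theorem IsErgodic.exists_hasSum_normalizedProj (hS : S.IsErgodic) (hN : 2 ≤ N)
    (hfin : ∀ α : Fin N → J, (indexClass e α).Finite) (hρ : IsDensityMatrix ψ ρ)
    (hρc : ρ ∈ S.conserved N) :
    ∃ w : {P : HN J N →L[ℂ] HN J N // S.IsMinimalProjection P} → ℝ,
      (∀ P, 0 ≤ w P) ∧ HasSum w 1 ∧ HasSum (fun P => (w P : ℂ) • normalizedProj P.1) ρ := by
  obtain ⟨a, hdiag, ha⟩ := (hS.mem_conserved_iff hN).1 hρc
  obtain ⟨r, hr0, hr1, hr⟩ := hρ.exists_real_diagonal hdiag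
  let c : (Fin N → J) → {P : HN J N →L[ℂ] HN J N // S.IsMinimalProjection P} := fun α =>
    ⟨coordProj (stdBasis _) (indexClass e α), (hS.isMinimalProjection_iff hN).2 ⟨α, rfl⟩⟩
  have hc : ∀ α β, c β = c α ↔ β ∈ indexClass e α := fun α β => by
    rw [Subtype.mk.injEq, (coordProj_injective _).eq_iff]
    exact ⟨fun h => h ▸ mem_indexClass_self, fun h => (Equivalent.indexClass_eq h).symm⟩
  have hfiber : ∀ P, (c ⁻¹' {P}).Finite ∧ coordProj (stdBasis _) (c ⁻¹' {P}) = P.1 := by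
    rintro ⟨P, hP⟩
    obtain ⟨α, rfl⟩ := (hS.isMinimalProjection_iff hN).1 hP
    have hα : c ⁻¹' {⟨_, hP⟩} = indexClass e α := Set.ext (hc α)
    rw [hα]
    exact ⟨hfin α, rfl⟩
  have hconst : ∀ α β, c α = c β → r α = r β := fun α β h => by
    have := Equivalent.apply_eq ha ((hc β α).1 h)
    rw [hr, hr] at this
    exact_mod_cast this.symm
  refine ⟨_, fun P => tsum_nonneg fun _ => hr0 _, hr1.tsum_fiberwise c, ?_⟩
  simpa only [(hfiber _).2] using hasSum_smul_normalizedProj_fiber (stdBasis _)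
    (fun P => (hfiber P).1) hr0 hr1.summable hconst fun α => by rw [hdiag, hr]

theorem IsErgodic.kacGenerator_eq_zero_iff_exists_hasSum (hS : S.IsErgodic) (hN : 2 ≤ N)
    (hfin : ∀ α : Fin N → J, (indexClass e α).Finite) (hρ : IsDensityMatrix ψ ρ) :
    S.kacGenerator ρ = 0 ↔ ∃ w : {P : HN J N →L[ℂ] HN J N // S.IsMinimalProjection P} → ℝ,
      (∀ P, 0 ≤ w P) ∧ HasSum w 1 ∧ HasSum (fun P => (w P : ℂ) • normalizedProj P.1) ρ := by
  constructor
  · intro h0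
    exact hS.exists_hasSum_normalizedProj hN hfin hρ
      (S.mem_conserved_of_kacGenerator_eq_zero _ hN hρ.hilbertSchmidtSq_ne_top h0)
  · rintro ⟨w, -, -, hw⟩
    exact S.kacGenerator_eq_zero_of_mem_conserved hN (S.mem_conserved_of_hasSum
      (fun P => S.smul_mem_conserved _ (S.smul_mem_conserved _ P.2.1)) hw)

end CollisionSpec

end SteadyStates

theorem theorem2p16_general {H : Type*} [NormedAddCommGroup H] [InnerProductSpace ℂ H]
    {J : Type*} (ψ : HilbertBasis J ℂ H) {e : J → ℝ}
    {C : Type*} [MetricSpace C] [CompactSpace C] [MeasurableSpace C] [BorelSpace C]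
    {S : CollisionSpec e C} (hS : S.IsErgodic) {N : ℕ} (hN : 2 ≤ N)
    (hfin : ∀ α₀ : Fin N → J, {α | Equivalent e α₀ α}.Finite) :
    (∀ P : HN J N →L[ℂ] HN J N, S.IsMinimalProjection P ↔
      ∃ α₀ : Fin N → J, P = ∑ᶠ α ∈ {α | Equivalent e α₀ α},
        InnerProductSpace.rankOne ℂ (basisVec ψ α) (basisVec ψ α)) ∧
    (∀ P : HN J N →L[ℂ] HN J N, S.IsMinimalProjection P →
      FiniteDimensional ℂ P.range ∧ IsDensityMatrix ψ (normalizedProj P)) ∧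
    ∀ ρ : HN J N →L[ℂ] HN J N, IsDensityMatrix ψ ρ →
      (S.kacGenerator ρ = 0 ↔
        ∃ w : {P : HN J N →L[ℂ] HN J N // S.IsMinimalProjection P} → ℝ,
          (∀ P, 0 ≤ w P) ∧ HasSum w 1 ∧
            HasSum (fun P => (w P : ℂ) • normalizedProj P.1) ρ) := by
  refine ⟨fun P => ?_, fun P hP => ?_,
    fun ρ hρ => hS.kacGenerator_eq_zero_iff_exists_hasSum hN hfin hρ⟩
  · simp only [hS.isMinimalProjection_iff hN, basisVec_eq_stdBasis]
    exact exists_congr fun α₀ => by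
      rw [coordProj_eq_finsum _ (s := indexClass e α₀) (hfin α₀), indexClass]
  · obtain ⟨α₀, rfl⟩ := (hS.isMinimalProjection_iff hN).1 hP
    exact ⟨finiteDimensional_range_coordProj _ (hfin α₀),
      isDensityMatrix_normalizedProj_coordProj ψ (hfin α₀) ⟨α₀, mem_indexClass_self⟩⟩

end QKac

open QKac in
theorem theorem2p16 {H : Type*} [NormedAddCommGroup H] [InnerProductSpace ℂ H] [CompleteSpace H]
    (h : H →ₗ.[ℂ] H) (hsa : IsSelfAdjoint h) (hres : HasCompactResolvent h)
    {J : Type*} (ψ : HilbertBasis J ℂ H) (e : J → ℝ)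
    (he : ∀ j, ∃ hj : ψ j ∈ h.domain, h ⟨ψ j, hj⟩ = (e j : ℂ) • ψ j)
    (hbdd : BddBelow (Set.range e))
    {C : Type*} [MetricSpace C] [CompactSpace C] [MeasurableSpace C] [BorelSpace C]
    (S : CollisionSpec e C) (hS : S.IsErgodic) (N : ℕ) (hN : 2 ≤ N) :
    -- the equivalence classes of indices are finite
    (∀ α₀ : Fin N → J, {α | Equivalent e α₀ α}.Finite) ∧
    -- the minimal projections are the sums over equivalence classes
    (∀ P : HN J N →L[ℂ] HN J N, S.IsMinimalProjection P ↔
      ∃ α₀ : Fin N → J, P = ∑ᶠ α ∈ {α | Equivalent e α₀ α},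
        InnerProductSpace.rankOne ℂ (basisVec ψ α) (basisVec ψ α)) ∧
    -- in particular they can be normalized
    (∀ P : HN J N →L[ℂ] HN J N, S.IsMinimalProjection P →
      FiniteDimensional ℂ P.range ∧ IsDensityMatrix ψ (normalizedProj P)) ∧
    -- the steady states are the (countable) convex combinations of normalized minimal projections
    ∀ ρ : HN J N →L[ℂ] HN J N, IsDensityMatrix ψ ρ →
      (S.kacGenerator ρ = 0 ↔
        ∃ w : {P : HN J N →L[ℂ] HN J N // S.IsMinimalProjection P} → ℝ,
          (∀ P, 0 ≤ w P) ∧ HasSum w 1 ∧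
            HasSum (fun P => (w P : ℂ) • normalizedProj P.1) ρ) := by
  have hfin : ∀ α₀ : Fin N → J, {α | Equivalent e α₀ α}.Finite :=
    finite_indexClass hbdd (hres.finite_setOf_le ψ.orthonormal he hbdd)
  exact ⟨hfin, theorem2p16_general ψ hS hN hfin⟩
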